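/- Let $\mathbb T^2=\mathbb S^1\times\mathbb S^1(1/\sqrt2)$ be the flat torus with arc length coordinates $(\gamma,\vartheta)$, $\gamma$ taken modulo $2\pi$ and $\vartheta$ modulo $\sqrt2\,\pi$, and let $\mathbb S^5\subset\mathbb C^3=\mathbb R^6$ be the unit sphere. Let $\varphi:\mathbb T^2\to\mathbb S^5$ be Sasahara's proper biharmonic Legendre embedding $$\varphi(\gamma,\vartheta)=\tfrac1{\sqrt2}\left(e^{\mathrm i\gamma},\ \mathrm i e^{-\mathrm i\gamma}\sin(\sqrt2\,\vartheta),\ \mathrm i e^{-\mathrm i\gamma}\cos(\sqrt2\,\vartheta)\right).$$ Let $\nabla$ be the connection induced by the Levi-Civita connection of $\mathbb S^5$ on $\varphi^{-1}T\mathbb S^5$, let $e_1=\partial/\partial\gamma$, $e_2=\partial/\partial\vartheta$, let $\tau=\sum_i\nabla_{e_i}d\varphi(e_i)$ be the tension field, and let $\overline\Delta=-\sum_i\nabla_{e_i}\nabla_{e_i}$. For smooth sections $V$ of $\varphi^{-1}T\mathbb S^5$ put $P V=\sum_i\langle V,d\varphi(e_i)\rangle\,d\varphi(e_i)$ and let $$\begin{aligned}I_2(V)={}&\overline\Delta^2V+\overline\Delta\big(PV-|d\varphi|^2V\big)+2\sum_i\langle\nabla_{e_i}\tau,d\varphi(e_i)\rangle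 V+|\tau|^2V-2\sum_i\langle V,\nabla_{e_i}\tau\rangle d\varphi(e_i)\\&-2\sum_i\langle\tau,\nabla_{e_i}V\rangle d\varphi(e_i)-\langle\tau,V\rangle\tau+P(\overline\Delta V)+P(PV)-2|d\varphi|^2PV\\&+2\sum_i\langle\nabla_{e_i}V,d\varphi(e_i)\rangle\tau-|d\varphi|^2\,\overline\Delta V+|d\varphi|^4V\end{aligned}$$ be the iterated Jacobi operator, which is the second variation operator of the bienergy $E_2(\varphi)=\frac12\int|\tau(\varphi)|^2$. Let $\mathrm{Index}(\varphi)$ be the sum of the dimensions of the eigenspaces of $I_2$ (in the real vector space of smooth sections) with negative eigenvalue, and let $\mathrm{Nullity}(\varphi)=\dim\{V: I_2(V)=0\}$. Then $$\mathrm{Index}(\varphi)=11\quad\text{and}\quad\mathrm{Nullity}(\varphi)=18 .$$ -/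

import Mathlib

open scoped ContDiff

noncomputable section

namespace BiharmonicIndex

/-- The flat torus `S¹ × S¹(1/√2)`: the product of a circle of length `2π` (radius `1`) and a
circle of length `√2 π` (radius `1/√2`), with arc length coordinates `(γ, ϑ)`. -/
abbrev FlatTorus : Type := AddCircle (2 * Real.pi) × AddCircle (Real.sqrt 2 * Real.pi)

namespace FlatTorus

/-- The projection from the plane onto the flat torus (a Riemannian covering). -/
def proj (x : ℝ × ℝ) : FlatTorus := ((x.1 : AddCircle _), (x.2 : AddCircle _))

/-- The coordinate directions of the plane; they project to the global orthonormal parallel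
frame `X₁ = ∂/∂γ`, `X₂ = ∂/∂ϑ` of the flat torus. -/
def dir (i : Fin 2) : ℝ × ℝ := if i = 0 then (1, 0) else (0, 1)

theorem proj_surjective : Function.Surjective proj := by
  rintro ⟨a, b⟩
  induction a using QuotientAddGroup.induction_on with | H a =>
  induction b using QuotientAddGroup.induction_on with | H b =>
  exact ⟨(a, b), rfl⟩

theorem proj_add (x y : ℝ × ℝ) : proj (x + y) = proj x + proj y := rfl

variable {E : Type*} [NormedAddCommGroup E] [NormedSpace ℝ E]

/-- A function on the torus is smooth if its doubly periodic lift to the plane is `C^∞`. -/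
def Smooth (F : FlatTorus → E) : Prop := ContDiff ℝ ∞ (F ∘ proj)

/-- The derivative of `F` in the direction of the frame field `Xᵢ`. -/
def frameDeriv (i : Fin 2) (F : FlatTorus → E) (p : FlatTorus) : E :=
  deriv (fun t : ℝ => F (p + proj (t • dir i))) 0

theorem frameDeriv_proj {F : FlatTorus → E} (hF : Smooth F) (i : Fin 2) (x : ℝ × ℝ) :
    frameDeriv i F (proj x) = fderiv ℝ (F ∘ proj) x (dir i) := by
  have h1 : HasFDerivAt (F ∘ proj) (fderiv ℝ (F ∘ proj) x) (x + (0 : ℝ) • dir i) := by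
    simpa using ((hF.differentiable (by simp)) x).hasFDerivAt
  have h2 : HasDerivAt (fun t : ℝ => x + t • dir i) (dir i) 0 := by
    simpa using ((hasDerivAt_id (0 : ℝ)).smul_const (dir i)).const_add x
  exact (h1.comp_hasDerivAt (0 : ℝ) h2).deriv

theorem Smooth.frameDeriv {F : FlatTorus → E} (hF : Smooth F) (i : Fin 2) :
    Smooth (frameDeriv i F) := by
  have h : FlatTorus.frameDeriv i F ∘ proj = fun x => fderiv ℝ (F ∘ proj) x (dir i) :=
    funext fun x => frameDeriv_proj hF i x
  unfold Smooth
  rw [h]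
  exact (hF.fderiv_right (m := ∞) (by simp)).clm_apply contDiff_const

theorem frameDeriv_add {F G : FlatTorus → E} (hF : Smooth F) (hG : Smooth G) (i : Fin 2)
    (p : FlatTorus) : frameDeriv i (F + G) p = frameDeriv i F p + frameDeriv i G p := by
  obtain ⟨x, rfl⟩ := proj_surjective p
  have hFG : Smooth (F + G) := ContDiff.add hF hG
  rw [frameDeriv_proj hF, frameDeriv_proj hG, frameDeriv_proj hFG]
  have : (F + G) ∘ proj = F ∘ proj + G ∘ proj := rfl
  rw [this, fderiv_add ((hF.differentiable (by simp)) x) ((hG.differentiable (by simp)) x)]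
  rfl

theorem frameDeriv_smul {F : FlatTorus → E} (hF : Smooth F) (c : ℝ) (i : Fin 2)
    (p : FlatTorus) : frameDeriv i (c • F) p = c • frameDeriv i F p := by
  obtain ⟨x, rfl⟩ := proj_surjective p
  have hcF : Smooth (c • F) := ContDiff.const_smul c hF
  rw [frameDeriv_proj hF, frameDeriv_proj hcF]
  have : (c • F) ∘ proj = c • (F ∘ proj) := rfl
  rw [this, fderiv_const_smul ((hF.differentiable (by simp)) x)]
  rfl

end FlatTorus

open FlatTorus

variable {E : Type*} [NormedAddCommGroup E] [InnerProductSpace ℝ E]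

/-- Smooth maps from the flat torus into the unit sphere of `E`. -/
structure SphereMap (E : Type*) [NormedAddCommGroup E] [InnerProductSpace ℝ E] where
  /-- the underlying map -/
  toFun : FlatTorus → Metric.sphere (0 : E) 1
  smooth : FlatTorus.Smooth (fun p => (toFun p : E))

namespace SphereMap

/-- The map, followed by the inclusion of the sphere into the ambient space. -/
def incl (φ : SphereMap E) (p : FlatTorus) : E := φ.toFun p

theorem inner_incl_self (φ : SphereMap E) (p : FlatTorus) :
    inner ℝ (φ.incl p) (φ.incl p) = 1 := by
  have h : ‖φ.incl p‖ = 1 := mem_sphere_zero_iff_norm.mp (φ.toFun p).2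
  rw [real_inner_self_eq_norm_sq, h, one_pow]

/-- The space of smooth sections of the pull-back of the tangent bundle of the sphere: smooth
`V` with `V(p) ∈ T_{φ(p)}S`, the orthogonal complement of `φ(p)` in `E`. -/
def Sections (φ : SphereMap E) : Submodule ℝ (FlatTorus → E) where
  carrier := {V | FlatTorus.Smooth V ∧ ∀ p, inner ℝ (φ.incl p) (V p) = 0}
  add_mem' {V W} hV hW := ⟨ContDiff.add hV.1 hW.1, fun p => by
    simp [inner_add_right, hV.2 p, hW.2 p]⟩
  zero_mem' := ⟨contDiff_const, fun p => by simp⟩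
  smul_mem' c V hV := ⟨ContDiff.const_smul c hV.1, fun p => by
    simp [inner_smul_right, hV.2 p]⟩

/-- The orthogonal projection of a vector of `E` onto the tangent space of the sphere at
`φ(p)`. -/
def tangProj (φ : SphereMap E) (p : FlatTorus) (v : E) : E :=
  v - inner ℝ (φ.incl p) v • φ.incl p

theorem tangProj_mem (φ : SphereMap E) {F : FlatTorus → E} (hF : FlatTorus.Smooth F) :
    (fun p => φ.tangProj p (F p)) ∈ φ.Sections := by
  refine ⟨?_, fun p => ?_⟩
  · exact ContDiff.sub hF (ContDiff.smul (ContDiff.inner ℝ φ.smooth hF) φ.smooth)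
  · simp only [tangProj, inner_sub_right, inner_smul_right, inner_incl_self, mul_one, sub_self]

/-- The section `dφ(Xᵢ)`. -/
def dφ (φ : SphereMap E) (i : Fin 2) : φ.Sections :=
  ⟨frameDeriv i φ.incl, FlatTorus.Smooth.frameDeriv φ.smooth i, fun p => by
    obtain ⟨x, rfl⟩ := proj_surjective p
    have hs : FlatTorus.Smooth φ.incl := φ.smooth
    rw [frameDeriv_proj hs]
    have hd : DifferentiableAt ℝ (φ.incl ∘ proj) x := hs.differentiable (by simp) x
    have h := fderiv_inner_apply ℝ hd hd (dir i)
    have hc : (fun t => inner ℝ ((φ.incl ∘ proj) t) ((φ.incl ∘ proj) t)) = fun _ => (1 : ℝ) :=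
      funext fun t => φ.inner_incl_self (proj t)
    rw [hc, real_inner_comm] at h
    simp only [fderiv_fun_const, Pi.zero_apply, _root_.zero_apply] at h
    have h' : inner ℝ ((φ.incl ∘ proj) x) (fderiv ℝ (φ.incl ∘ proj) x (dir i)) = 0 := by
      linarith [real_inner_comm ((φ.incl ∘ proj) x) (fderiv ℝ (φ.incl ∘ proj) x (dir i))]
    exact h'⟩

/-- The covariant derivative of sections in the direction `Xᵢ`, for the pull-back of the
Levi-Civita connection of the sphere: the tangential part of the derivative in `E`. -/
def nabla (φ : SphereMap E) (i : Fin 2) : Module.End ℝ φ.Sections where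
  toFun V := ⟨fun p => φ.tangProj p (frameDeriv i (V : FlatTorus → E) p),
    φ.tangProj_mem (FlatTorus.Smooth.frameDeriv V.2.1 i)⟩
  map_add' V W := Subtype.ext <| funext fun p => by
    simp only [Submodule.coe_add, Pi.add_apply, tangProj, frameDeriv_add V.2.1 W.2.1 i p,
      inner_add_right, add_smul]
    abel
  map_smul' c V := Subtype.ext <| funext fun p => by
    simp only [Submodule.coe_smul, Pi.smul_apply, tangProj, frameDeriv_smul V.2.1 c i p,
      inner_smul_right, RingHom.id_apply, smul_sub, mul_smul]

/-- The tension field `τ(φ) = trace ∇dφ`; the frame is parallel, so `∇_{Xᵢ} Xᵢ = 0`. -/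
def tension (φ : SphereMap E) : φ.Sections := ∑ i, φ.nabla i (φ.dφ i)

/-- The rough Laplacian on sections, with the sign that makes it a nonnegative operator. -/
def roughLaplacian (φ : SphereMap E) : Module.End ℝ φ.Sections := -∑ i, φ.nabla i * φ.nabla i

/-- For sections `A`, `B`, the operator `V ↦ ⟨A, B⟩ V`. -/
def scale (φ : SphereMap E) (A B : φ.Sections) : Module.End ℝ φ.Sections where
  toFun V := ⟨fun p => (inner ℝ (A.1 p) (B.1 p) : ℝ) • V.1 p,
    ContDiff.smul (ContDiff.inner ℝ A.2.1 B.2.1) V.2.1, fun p => by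
      simp [inner_smul_right, V.2.2 p]⟩
  map_add' V W := Subtype.ext <| funext fun p => by simp
  map_smul' c V := Subtype.ext <| funext fun p => by
    simp [smul_comm c (inner ℝ (A.1 p) (B.1 p) : ℝ) (V.1 p)]

/-- For sections `A`, `B`, the operator `V ↦ ⟨A, V⟩ B`. -/
def contract (φ : SphereMap E) (A B : φ.Sections) : Module.End ℝ φ.Sections where
  toFun V := ⟨fun p => (inner ℝ (A.1 p) (V.1 p) : ℝ) • B.1 p,
    ContDiff.smul (ContDiff.inner ℝ A.2.1 V.2.1) B.2.1, fun p => by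
      simp [inner_smul_right, B.2.2 p]⟩
  map_add' V W := Subtype.ext <| funext fun p => by simp [inner_add_right, add_smul]
  map_smul' c V := Subtype.ext <| funext fun p => by simp [inner_smul_right, mul_smul]

/-- Multiplication by `|dφ|²`. -/
def normSqDφ (φ : SphereMap E) : Module.End ℝ φ.Sections := ∑ i, φ.scale (φ.dφ i) (φ.dφ i)

/-- The operator `V ↦ trace ⟨V, dφ·⟩ dφ·`. -/
def traceDφ (φ : SphereMap E) : Module.End ℝ φ.Sections := ∑ i, φ.contract (φ.dφ i) (φ.dφ i)

/-- The iterated Jacobi operator `I₂`, i.e. the second variation operator of the bienergy, for a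
map into a unit sphere:
`I₂(V) = Δ̄²V + Δ̄(trace⟨V,dφ·⟩dφ· - |dφ|²V) + 2⟨dτ,dφ⟩V + |τ|²V - 2 trace⟨V,dτ·⟩dφ·`
`- 2 trace⟨τ,dV·⟩dφ· - ⟨τ,V⟩τ + trace⟨dφ·,Δ̄V⟩dφ· + trace⟨dφ·,trace⟨V,dφ·⟩dφ·⟩dφ·`
`- 2|dφ|² trace⟨dφ·,V⟩dφ· + 2⟨dV,dφ⟩τ - |dφ|²Δ̄V + |dφ|⁴V`.
Products of operators are compositions. -/
def jacobi2 (φ : SphereMap E) : Module.End ℝ φ.Sections :=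
  φ.roughLaplacian * φ.roughLaplacian
    + φ.roughLaplacian * (φ.traceDφ - φ.normSqDφ)
    + (2 : ℝ) • ∑ i, φ.scale (φ.nabla i φ.tension) (φ.dφ i)
    + φ.scale φ.tension φ.tension
    - (2 : ℝ) • ∑ i, φ.contract (φ.nabla i φ.tension) (φ.dφ i)
    - (2 : ℝ) • ∑ i, φ.contract φ.tension (φ.dφ i) * φ.nabla i
    - φ.contract φ.tension φ.tension
    + φ.traceDφ * φ.roughLaplacian
    + φ.traceDφ * φ.traceDφ
    - (2 : ℝ) • (φ.normSqDφ * φ.traceDφ)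
    + (2 : ℝ) • ∑ i, φ.contract (φ.dφ i) φ.tension * φ.nabla i
    - φ.normSqDφ * φ.roughLaplacian
    + φ.normSqDφ * φ.normSqDφ

/-- The index: the sum of the dimensions of the eigenspaces of `I₂` over all negative real
numbers (the eigenspace is zero unless the number is an eigenvalue). -/
def index (φ : SphereMap E) : Cardinal :=
  Cardinal.sum fun μ : Set.Iio (0 : ℝ) =>
    Module.rank ℝ (Module.End.eigenspace φ.jacobi2 (μ : ℝ))

/-- The nullity: the dimension of the kernel of `I₂`. -/
def nullity (φ : SphereMap E) : Cardinal := Module.rank ℝ (LinearMap.ker φ.jacobi2)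

end SphereMap

/-- Sasahara's map into `ℂ³`, as a function on the torus. On the first factor `toCircle γ` is
`e^{iγ}`, on the second one `toCircle ϑ` is `e^{i√2ϑ}`. -/
def sasaharaFun (p : FlatTorus) : EuclideanSpace ℂ (Fin 3) :=
  ((1 / Real.sqrt 2 : ℝ) : ℂ) • !₂[(AddCircle.toCircle p.1 : ℂ),
    Complex.I * (AddCircle.toCircle (-p.1) : ℂ) * ((AddCircle.toCircle p.2 : ℂ).im : ℂ),
    Complex.I * (AddCircle.toCircle (-p.1) : ℂ) * ((AddCircle.toCircle p.2 : ℂ).re : ℂ)]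

/-- In coordinates:
`Φ(γ, ϑ) = (1/√2) (e^{iγ}, i e^{-iγ} sin(√2 ϑ), i e^{-iγ} cos(√2 ϑ))`. -/
theorem sasaharaFun_proj (γ ϑ : ℝ) :
    sasaharaFun (FlatTorus.proj (γ, ϑ)) = ((1 / Real.sqrt 2 : ℝ) : ℂ) •
      !₂[Complex.exp (Complex.I * γ),
        Complex.I * Complex.exp (-(Complex.I * γ)) * (Real.sin (Real.sqrt 2 * ϑ) : ℂ),
        Complex.I * Complex.exp (-(Complex.I * γ)) * (Real.cos (Real.sqrt 2 * ϑ) : ℂ)] := by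
  have hpi : Real.pi ≠ 0 := Real.pi_ne_zero
  have h1 : 2 * Real.pi / (2 * Real.pi) * γ = γ := by field_simp
  have h2 : 2 * Real.pi / (Real.sqrt 2 * Real.pi) * ϑ = Real.sqrt 2 * ϑ := by
    have hs : Real.sqrt 2 ≠ 0 := by positivity
    field_simp
    rw [Real.sq_sqrt (by norm_num)]
  unfold sasaharaFun FlatTorus.proj
  simp only [AddCircle.toCircle_neg, AddCircle.toCircle_apply_mk, h1, h2, Circle.coe_exp,
    Circle.coe_inv, Complex.exp_ofReal_mul_I_re, Complex.exp_ofReal_mul_I_im, Complex.exp_neg,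
    mul_comm Complex.I (γ : ℂ)]

theorem sasaharaFun_norm (p : FlatTorus) : ‖sasaharaFun p‖ = 1 := by
  obtain ⟨⟨γ, ϑ⟩, rfl⟩ := FlatTorus.proj_surjective p
  have h := Real.sin_sq_add_cos_sq (Real.sqrt 2 * ϑ)
  have e1 : ‖Complex.exp (Complex.I * γ)‖ = 1 := by
    rw [mul_comm, Complex.norm_exp_ofReal_mul_I]
  rw [sasaharaFun_proj, norm_smul, EuclideanSpace.norm_eq]
  simp only [Fin.sum_univ_three, Complex.norm_real, Real.norm_eq_abs, norm_mul, Complex.norm_I,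
    Complex.exp_neg, norm_inv, e1, one_div, Matrix.cons_val_zero,
    Matrix.cons_val_one, Matrix.cons_val_two, Matrix.head_cons, Matrix.tail_cons,
    inv_one, one_mul, one_pow, sq_abs]
  rw [add_assoc, h, abs_of_nonneg (Real.sqrt_nonneg 2)]
  norm_num

theorem sasaharaFun_smooth : FlatTorus.Smooth sasaharaFun := by
  unfold FlatTorus.Smooth
  have h : sasaharaFun ∘ FlatTorus.proj = fun x : ℝ × ℝ => ((1 / Real.sqrt 2 : ℝ) : ℂ) •
      !₂[Complex.exp (Complex.I * x.1),
        Complex.I * Complex.exp (-(Complex.I * x.1)) * (Real.sin (Real.sqrt 2 * x.2) : ℂ),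
        Complex.I * Complex.exp (-(Complex.I * x.1)) * (Real.cos (Real.sqrt 2 * x.2) : ℂ)] :=
    funext fun x => sasaharaFun_proj x.1 x.2
  have ho : ∀ {f : ℝ × ℝ → ℝ}, ContDiff ℝ ∞ f → ContDiff ℝ ∞ (fun x => (f x : ℂ)) :=
    fun hf => Complex.ofRealCLM.contDiff.comp hf
  rw [h]
  refine ContDiff.const_smul _ ?_
  refine (contDiff_piLp 2).mpr ?_
  have c1 : ContDiff ℝ ∞ (fun x : ℝ × ℝ => Complex.I * (x.1 : ℂ)) :=
    contDiff_const.mul (ho contDiff_fst)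
  have cs : ContDiff ℝ ∞ (fun x : ℝ × ℝ => (Real.sin (Real.sqrt 2 * x.2) : ℂ)) :=
    ho (Real.contDiff_sin.comp (contDiff_const.mul contDiff_snd))
  have cc : ContDiff ℝ ∞ (fun x : ℝ × ℝ => (Real.cos (Real.sqrt 2 * x.2) : ℂ)) :=
    ho (Real.contDiff_cos.comp (contDiff_const.mul contDiff_snd))
  intro i
  fin_cases i
  · exact c1.cexp
  · exact (contDiff_const.mul c1.neg.cexp).mul cs
  · exact (contDiff_const.mul c1.neg.cexp).mul cc

/-- Sasahara's proper biharmonic Legendre embedding of the flat torus into `S⁵ ⊂ ℂ³`, where `ℂ³`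
carries the real inner product `Re ⟨z, w⟩`. -/
def sasahara : SphereMap (EuclideanSpace ℂ (Fin 3)) where
  toFun p := ⟨sasaharaFun p, by simpa using sasaharaFun_norm p⟩
  smooth := sasaharaFun_smooth

end BiharmonicIndex

end

open MeasureTheory

noncomputable section

namespace BiharmonicIndex

/-! The vectors `φ`, `X₁ = dφ(e₁)`, `X₂ = dφ(e₂)` form a unitary frame of `ℂ³` at every point, so
the pull-back bundle is trivialised by the real orthonormal frame `X₁, X₂, iX₁, iX₂, iφ`. In this
frame the connection has constant coefficients and `τ = -iX₁`. Hence `I₂` is a fourth-order operator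
with constant coefficients, and Fourier analysis splits it into finite blocks.

The splitting is done over `ℝ` with the Hartley functions `cas = cos + sin`. A frame derivative
sends `cas k` to a multiple of `cas (-k)`, while the zeroth-order part of the connection exchanges
the groups `{X₁, X₂, iφ}` and `{iX₁, iX₂}`. With `cas k` attached to the first group and `cas (-k)`
to the second, `∇` maps the mode `k` to the mode `-k`, and `I₂` preserves each five-dimensional
mode. There it acts by a symmetric matrix, the symbol at `s = m`, `t = √2 n` for `k = (m, n)`
(`jacobi2_modeField`).

The formal adjoint of `I₂` agrees with `I₂` on modes, so taking coefficients intertwines `I₂` with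
the symbols (`pairing_jacobi2`). The modes are orthonormal and complete, so an eigenspace of `I₂` is
the sum of those of the blocks as soon as finitely many blocks contribute
(`rank_eigenspace_jacobi2`).

The determinant of `y + symbol s t` is a quintic in `y` whose coefficients are positive if `|m| ≥
3`, or `|n| ≥ 3`, or `m ≠ 0` and `|n| ≥ 2` (`symbolDet_pos`); such modes have only positive
eigenvalues. Up to signs seven modes remain, and factoring their characteristic polynomials gives
the counts that add up to 11 and 18. -/

instance fact_two_pi_pos : Fact (0 < 2 * Real.pi) := ⟨Real.two_pi_pos⟩

instance fact_sqrt_two_mul_pi_pos : Fact (0 < Real.sqrt 2 * Real.pi) :=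
  ⟨mul_pos (by positivity) Real.pi_pos⟩

namespace FlatTorus

/-! ### Frame derivatives on the flat torus -/

section Calculus

variable {E : Type*} [NormedAddCommGroup E] [NormedSpace ℝ E]

/-- Lets continuity, and so integrability, descend from the periodic lift to the torus. -/
theorem isOpenQuotientMap_proj : IsOpenQuotientMap proj :=
  (QuotientAddGroup.isOpenQuotientMap_mk (N := AddSubgroup.zmultiples (2 * Real.pi))).prodMap
    (QuotientAddGroup.isOpenQuotientMap_mk
      (N := AddSubgroup.zmultiples (Real.sqrt 2 * Real.pi)))

theorem Smooth.continuous {F : FlatTorus → E} (hF : Smooth F) : Continuous F :=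
  isOpenQuotientMap_proj.isQuotientMap.continuous_iff.mpr (ContDiff.continuous hF)

theorem Smooth.hasDerivAt {F : FlatTorus → E} (hF : Smooth F) (i : Fin 2) (p : FlatTorus)
    (t : ℝ) : HasDerivAt (fun t : ℝ => F (p + proj (t • dir i)))
      (FlatTorus.frameDeriv i F (p + proj (t • dir i))) t := by
  obtain ⟨x, rfl⟩ := proj_surjective p
  rw [← proj_add, frameDeriv_proj hF]
  have h1 : HasFDerivAt (F ∘ proj) (fderiv ℝ (F ∘ proj) (x + t • dir i)) (x + t • dir i) :=
    ((hF.differentiable (by simp)) _).hasFDerivAt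
  have h2 : HasDerivAt (fun t : ℝ => x + t • dir i) (dir i) t := by
    simpa using ((hasDerivAt_id t).smul_const (dir i)).const_add x
  exact h1.comp_hasDerivAt t h2

theorem Smooth.hasDerivAt_zero {F : FlatTorus → E} (hF : Smooth F) (i : Fin 2) (p : FlatTorus) :
    HasDerivAt (fun t : ℝ => F (p + proj (t • dir i))) (FlatTorus.frameDeriv i F p) 0 := by
  have h0 : p + proj ((0 : ℝ) • dir i) = p := by
    rw [zero_smul]
    exact add_zero p
  simpa only [h0] using hF.hasDerivAt i p 0

theorem frameDeriv_smul_fun {g : FlatTorus → ℝ} {F : FlatTorus → E} (hg : Smooth g)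
    (hF : Smooth F) (i : Fin 2) (p : FlatTorus) :
    frameDeriv i (fun q => g q • F q) p = g p • frameDeriv i F p + frameDeriv i g p • F p := by
  have h0 : p + proj ((0 : ℝ) • dir i) = p := by
    rw [zero_smul]
    exact add_zero p
  have h := ((hg.hasDerivAt_zero i p).fun_smul (hF.hasDerivAt_zero i p)).deriv
  simp only [h0] at h
  exact h

theorem frameDeriv_clm_comp {E' : Type*} [NormedAddCommGroup E'] [NormedSpace ℝ E']
    (L : E →L[ℝ] E') {F : FlatTorus → E} (hF : Smooth F) (i : Fin 2) (p : FlatTorus) :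
    frameDeriv i (fun q => L (F q)) p = L (frameDeriv i F p) :=
  (L.hasFDerivAt.comp_hasDerivAt (0 : ℝ) (hF.hasDerivAt_zero i p)).deriv

theorem Smooth.clm_comp {E' : Type*} [NormedAddCommGroup E'] [NormedSpace ℝ E']
    (L : E →L[ℝ] E') {F : FlatTorus → E} (hF : Smooth F) : Smooth fun q => L (F q) :=
  L.contDiff.comp hF

end Calculus

theorem frameDeriv_inner {E : Type*} [NormedAddCommGroup E] [InnerProductSpace ℝ E]
    {F G : FlatTorus → E} (hF : Smooth F) (hG : Smooth G) (i : Fin 2) (p : FlatTorus) :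
    frameDeriv i (fun q => inner ℝ (F q) (G q)) p
      = inner ℝ (F p) (frameDeriv i G p) + inner ℝ (frameDeriv i F p) (G p) := by
  have h0 : p + proj ((0 : ℝ) • dir i) = p := by
    rw [zero_smul]
    exact add_zero p
  have h := ((hF.hasDerivAt_zero i p).inner ℝ (hG.hasDerivAt_zero i p)).deriv
  simp only [h0] at h
  exact h

/-! ### Integration on the torus -/

/-- The invariant probability measure of the flat torus. -/
def vol : Measure FlatTorus :=
  (AddCircle.haarAddCircle (T := 2 * Real.pi)).prod
    (AddCircle.haarAddCircle (T := Real.sqrt 2 * Real.pi))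

instance : IsProbabilityMeasure vol := by unfold vol; infer_instance

instance : vol.IsAddLeftInvariant := by unfold vol; infer_instance

theorem integrable_of_continuous {E : Type*} [NormedAddCommGroup E] {F : FlatTorus → E}
    (hF : Continuous F) : Integrable F vol :=
  hF.integrable_of_hasCompactSupport (HasCompactSupport.of_compactSpace F)

/-- Divergence theorem on the torus: the integral of a frame derivative vanishes. -/
theorem integral_frameDeriv {F : FlatTorus → ℝ} (hF : Smooth F) (i : Fin 2) :
    ∫ p, frameDeriv i F p ∂vol = 0 := by
  have hc : Continuous (frameDeriv i F) := (hF.frameDeriv i).continuous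
  obtain ⟨C, hC⟩ := isCompact_univ.exists_bound_of_continuousOn hc.continuousOn
  have hsh : ∀ t : ℝ, Continuous fun p : FlatTorus => p + proj (t • dir i) :=
    fun t => continuous_add_const _
  have h := (hasDerivAt_integral_of_dominated_loc_of_deriv_le (μ := vol) (𝕜 := ℝ)
    (F := fun t p => F (p + proj (t • dir i)))
    (F' := fun t p => frameDeriv i F (p + proj (t • dir i))) (x₀ := 0) (s := Set.univ)
    (bound := fun _ => C) Filter.univ_mem
    (Filter.Eventually.of_forall fun t =>
      (integrable_of_continuous (hF.continuous.comp (hsh t))).aestronglyMeasurable)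
    (integrable_of_continuous (hF.continuous.comp (hsh 0)))
    (integrable_of_continuous (hc.comp (hsh 0))).aestronglyMeasurable
    (Filter.Eventually.of_forall fun p t _ => hC _ (Set.mem_univ _))
    (integrable_const C)
    (Filter.Eventually.of_forall fun p t _ => hF.hasDerivAt i p t)).2
  -- By translation invariance the integral of the translates does not depend on `t`; its derivative
  -- at `0`, taken under the integral sign, therefore vanishes.
  have hconst : (fun t : ℝ => ∫ p, F (p + proj (t • dir i)) ∂vol) = fun _ => ∫ p, F p ∂vol :=
    funext fun t => integral_add_right_eq_self F _
  rw [hconst] at h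
  have h' := h.unique (hasDerivAt_const (0 : ℝ) (∫ p, F p ∂vol))
  rwa [integral_add_right_eq_self (frameDeriv i F) (proj ((0 : ℝ) • dir i))] at h'

/-! ### Hartley functions: derivatives, orthonormality, completeness -/

/-- The frequency of the character with index `k` in the direction of `Xᵢ`. -/
def freq (i : Fin 2) (k : ℤ × ℤ) : ℝ := if i = 0 then k.1 else Real.sqrt 2 * k.2

theorem freq_zero (k : ℤ × ℤ) : freq 0 k = k.1 := rfl

theorem freq_one (k : ℤ × ℤ) : freq 1 k = Real.sqrt 2 * k.2 := rfl

theorem freq_neg (i : Fin 2) (k : ℤ × ℤ) : freq i (-k) = -freq i k := by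
  unfold freq; split_ifs <;> simp

/-- The characters of the flat torus. -/
def char (k : ℤ × ℤ) (p : FlatTorus) : ℂ := fourier k.1 p.1 * fourier k.2 p.2

theorem char_proj (k : ℤ × ℤ) (x : ℝ × ℝ) :
    char k (proj x) = Complex.exp ((freq 0 k * x.1 + freq 1 k * x.2 : ℝ) * Complex.I) := by
  have hpi : (Real.pi : ℂ) ≠ 0 := by exact_mod_cast Real.pi_ne_zero
  have hs : ((Real.sqrt 2 : ℝ) : ℂ) ≠ 0 := by
    exact_mod_cast (by positivity : Real.sqrt 2 ≠ 0)
  have h2 : ((Real.sqrt 2 : ℝ) : ℂ) ^ 2 = 2 := by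
    exact_mod_cast Real.sq_sqrt (by norm_num : (0 : ℝ) ≤ 2)
  unfold char proj
  rw [fourier_coe_apply, fourier_coe_apply, ← Complex.exp_add, freq_zero, freq_one]
  congr 1
  push_cast
  field_simp
  linear_combination (-(k.2 * x.2 : ℂ)) * h2

/-- Cosine of the phase of a character. -/
def cosFun (k : ℤ × ℤ) (p : FlatTorus) : ℝ := (char k p).re

/-- Sine of the phase of a character. -/
def sinFun (k : ℤ × ℤ) (p : FlatTorus) : ℝ := (char k p).im

theorem cosFun_proj (k : ℤ × ℤ) (x : ℝ × ℝ) :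
    cosFun k (proj x) = Real.cos (freq 0 k * x.1 + freq 1 k * x.2) := by
  rw [cosFun, char_proj, Complex.exp_ofReal_mul_I_re]

theorem sinFun_proj (k : ℤ × ℤ) (x : ℝ × ℝ) :
    sinFun k (proj x) = Real.sin (freq 0 k * x.1 + freq 1 k * x.2) := by
  rw [sinFun, char_proj, Complex.exp_ofReal_mul_I_im]

/-- The Hartley functions `cos + sin`, a real orthonormal basis of trigonometric functions. -/
def cas (k : ℤ × ℤ) (p : FlatTorus) : ℝ := cosFun k p + sinFun k p

theorem smooth_cosFun (k : ℤ × ℤ) : Smooth (cosFun k) := by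
  have : cosFun k ∘ proj = fun x : ℝ × ℝ => Real.cos (freq 0 k * x.1 + freq 1 k * x.2) :=
    funext fun x => cosFun_proj k x
  unfold Smooth
  rw [this]
  fun_prop

theorem smooth_sinFun (k : ℤ × ℤ) : Smooth (sinFun k) := by
  have : sinFun k ∘ proj = fun x : ℝ × ℝ => Real.sin (freq 0 k * x.1 + freq 1 k * x.2) :=
    funext fun x => sinFun_proj k x
  unfold Smooth
  rw [this]
  fun_prop

theorem smooth_cas (k : ℤ × ℤ) : Smooth (cas k) := ContDiff.add (smooth_cosFun k) (smooth_sinFun k)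

theorem phase_add (k : ℤ × ℤ) (x : ℝ × ℝ) (i : Fin 2) (t : ℝ) :
    freq 0 k * (x + t • dir i).1 + freq 1 k * (x + t • dir i).2
      = freq 0 k * x.1 + freq 1 k * x.2 + t * freq i k := by
  fin_cases i <;> simp [dir] <;> ring

theorem hasDerivAt_phase (k : ℤ × ℤ) (x : ℝ × ℝ) (i : Fin 2) :
    HasDerivAt (fun t : ℝ => freq 0 k * x.1 + freq 1 k * x.2 + t * freq i k) (freq i k) 0 := by
  simpa using ((hasDerivAt_id (0 : ℝ)).mul_const (freq i k)).const_add
    (freq 0 k * x.1 + freq 1 k * x.2)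

theorem frameDeriv_cosFun (i : Fin 2) (k : ℤ × ℤ) (p : FlatTorus) :
    frameDeriv i (cosFun k) p = -(freq i k * sinFun k p) := by
  obtain ⟨x, rfl⟩ := proj_surjective p
  unfold frameDeriv
  simp only [← proj_add, cosFun_proj, sinFun_proj, phase_add]
  rw [(hasDerivAt_phase k x i).cos.deriv]
  simp; ring

theorem frameDeriv_sinFun (i : Fin 2) (k : ℤ × ℤ) (p : FlatTorus) :
    frameDeriv i (sinFun k) p = freq i k * cosFun k p := by
  obtain ⟨x, rfl⟩ := proj_surjective p
  unfold frameDeriv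
  simp only [← proj_add, cosFun_proj, sinFun_proj, phase_add]
  rw [(hasDerivAt_phase k x i).sin.deriv]
  simp; ring

theorem cosFun_neg (k : ℤ × ℤ) (p : FlatTorus) : cosFun (-k) p = cosFun k p := by
  obtain ⟨x, rfl⟩ := proj_surjective p
  rw [cosFun_proj, cosFun_proj, freq_neg, freq_neg, ← Real.cos_neg]
  congr 1; ring

theorem sinFun_neg (k : ℤ × ℤ) (p : FlatTorus) : sinFun (-k) p = -sinFun k p := by
  obtain ⟨x, rfl⟩ := proj_surjective p
  rw [sinFun_proj, sinFun_proj, freq_neg, freq_neg, ← Real.sin_neg]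
  congr 1; ring

/-- The reason for using Hartley functions: differentiation permutes them up to real factors, with
one real function for each `k`, so real multiplicities are read off directly. -/
theorem frameDeriv_cas (i : Fin 2) (k : ℤ × ℤ) (p : FlatTorus) :
    frameDeriv i (cas k) p = freq i k * cas (-k) p := by
  have h := frameDeriv_add (smooth_cosFun k) (smooth_sinFun k) i p
  have hc : cas k = cosFun k + sinFun k := rfl
  rw [hc, h, frameDeriv_cosFun, frameDeriv_sinFun, cas, cosFun_neg, sinFun_neg]
  ring

/-- Orthonormality follows from this form: the sine always has mean zero, and the cosine does unless
`k = l`. -/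
theorem cas_mul_cas (k l : ℤ × ℤ) (p : FlatTorus) :
    cas k p * cas l p = cosFun (k - l) p + sinFun (k + l) p := by
  obtain ⟨x, rfl⟩ := proj_surjective p
  have h1 : ∀ i, freq i (k + l) = freq i k + freq i l := fun i => by
    unfold freq; split_ifs <;> simp [mul_add]
  have h2 : ∀ i, freq i (k - l) = freq i k - freq i l := fun i => by
    unfold freq; split_ifs <;> simp [mul_sub]
  simp only [cas, cosFun_proj, sinFun_proj, h1, h2]
  have e1 : (freq 0 k - freq 0 l) * x.1 + (freq 1 k - freq 1 l) * x.2
    = (freq 0 k * x.1 + freq 1 k * x.2) - (freq 0 l * x.1 + freq 1 l * x.2) := by ring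
  have e2 : (freq 0 k + freq 0 l) * x.1 + (freq 1 k + freq 1 l) * x.2
    = (freq 0 k * x.1 + freq 1 k * x.2) + (freq 0 l * x.1 + freq 1 l * x.2) := by ring
  rw [e1, e2]
  generalize freq 0 k * x.1 + freq 1 k * x.2 = a
  generalize freq 0 l * x.1 + freq 1 l * x.2 = b
  rw [Real.cos_sub, Real.sin_add]
  ring

theorem exists_freq_ne_zero {k : ℤ × ℤ} (hk : k ≠ 0) : ∃ i, freq i k ≠ 0 := by
  by_contra! h
  apply hk
  have h0 := h 0
  have h1 := h 1
  rw [freq_zero] at h0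
  rw [freq_one] at h1
  have hs : Real.sqrt 2 ≠ 0 := by positivity
  ext
  · exact_mod_cast h0
  · simpa [hs] using h1

theorem integral_cosFun (k : ℤ × ℤ) : ∫ p, cosFun k p ∂vol = if k = 0 then 1 else 0 := by
  split_ifs with hk
  · have : cosFun k = fun _ => (1 : ℝ) := by
      funext p
      obtain ⟨x, rfl⟩ := proj_surjective p
      simp [cosFun_proj, hk, freq]
    simp [this]
  -- For `k ≠ 0` the cosine is, up to a nonzero factor, a frame derivative of the sine.
  · obtain ⟨i, hi⟩ := exists_freq_ne_zero hk
    have h := integral_frameDeriv (smooth_sinFun k) i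
    simp only [frameDeriv_sinFun, integral_const_mul] at h
    exact (mul_eq_zero.mp h).resolve_left hi

theorem integral_sinFun (k : ℤ × ℤ) : ∫ p, sinFun k p ∂vol = 0 := by
  by_cases hk : k = 0
  · have : sinFun k = fun _ => (0 : ℝ) := by
      funext p
      obtain ⟨x, rfl⟩ := proj_surjective p
      simp [sinFun_proj, hk, freq]
    simp [this]
  · obtain ⟨i, hi⟩ := exists_freq_ne_zero hk
    have h := integral_frameDeriv (smooth_cosFun k) i
    simp only [frameDeriv_cosFun, integral_neg, integral_const_mul, neg_eq_zero] at h
    exact (mul_eq_zero.mp h).resolve_left hi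

theorem integral_cas_mul_cas (k l : ℤ × ℤ) :
    ∫ p, cas k p * cas l p ∂vol = if k = l then 1 else 0 := by
  simp only [cas_mul_cas]
  rw [integral_add (integrable_of_continuous (smooth_cosFun _).continuous)
    (integrable_of_continuous (smooth_sinFun _).continuous), integral_cosFun, integral_sinFun]
  simp [sub_eq_zero]

/-- Vanishing coefficients are summable, so the Fourier series converges pointwise to `f`; all its
terms are zero. -/
theorem eq_zero_of_fourierCoeff_eq_zero {T : ℝ} [Fact (0 < T)] {f : AddCircle T → ℂ}
    (hf : Continuous f) (h : ∀ n, fourierCoeff f n = 0) (x : AddCircle T) : f x = 0 := by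
  let g : C(AddCircle T, ℂ) := ⟨f, hf⟩
  have hg : ∀ n, fourierCoeff g n = 0 := h
  have hs : Summable (fourierCoeff g) := by
    rw [funext hg]
    exact summable_zero
  have h1 := has_pointwise_sum_fourier_series_of_summable hs x
  simp only [hg, zero_smul] at h1
  exact h1.unique hasSum_zero

/-- Completeness of the characters. -/
theorem eq_zero_of_integral_mul_char_eq_zero {F : FlatTorus → ℂ} (hF : Continuous F)
    (h : ∀ k, ∫ p, char k p * F p ∂vol = 0) : F = 0 := by
  have hG : ∀ m : ℤ, Continuous fun b : AddCircle (Real.sqrt 2 * Real.pi) =>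
      ∫ a, fourier m a * F (a, b) ∂AddCircle.haarAddCircle := fun m => by
    have hc : Continuous (Function.uncurry fun (b : AddCircle (Real.sqrt 2 * Real.pi))
        (a : AddCircle (2 * Real.pi)) => fourier m a * F (a, b)) := by
      refine Continuous.mul ((map_continuous (fourier m)).comp continuous_snd) ?_
      exact hF.comp (continuous_snd.prodMk continuous_fst)
    simpa using continuous_parametric_integral_of_continuous
      (μ := AddCircle.haarAddCircle) hc isCompact_univ
  have h0 : ∀ (m : ℤ) (b : AddCircle (Real.sqrt 2 * Real.pi)),
      ∫ a, fourier m a * F (a, b) ∂AddCircle.haarAddCircle = 0 := fun m =>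
    eq_zero_of_fourierCoeff_eq_zero (hG m) fun n => by
      -- `fourierCoeff` at `n` pairs with the character of index `-n`.
      have hk := h (m, -n)
      have hc : Continuous fun p => char (m, -n) p * F p :=
        (((map_continuous (fourier m)).comp continuous_fst).mul
          ((map_continuous (fourier (-n))).comp continuous_snd)).mul hF
      unfold vol at hk
      rw [integral_prod_symm _ (integrable_of_continuous hc)] at hk
      rw [fourierCoeff, ← hk]
      refine integral_congr_ae (Filter.Eventually.of_forall fun b => ?_)
      simp only [char, smul_eq_mul]
      rw [← integral_const_mul]
      refine integral_congr_ae (Filter.Eventually.of_forall fun a => ?_)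
      simp only
      ring
  funext ⟨a, b⟩
  refine eq_zero_of_fourierCoeff_eq_zero (f := fun a => F (a, b))
    (hF.comp (continuous_id.prodMk continuous_const)) (fun n => ?_) a
  rw [fourierCoeff, ← h0 (-n) b]
  rfl

/-- Completeness of the Hartley functions. -/
theorem eq_zero_of_integral_mul_cas_eq_zero {F : FlatTorus → ℝ} (hF : Continuous F)
    (h : ∀ k, ∫ p, cas k p * F p ∂vol = 0) : F = 0 := by
  have hc : ∀ k, Integrable (fun p => cosFun k p * F p) vol := fun k =>
    integrable_of_continuous ((smooth_cosFun k).continuous.mul hF)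
  have hs : ∀ k, Integrable (fun p => sinFun k p * F p) vol := fun k =>
    integrable_of_continuous ((smooth_sinFun k).continuous.mul hF)
  have h1 : ∀ k, ∫ p, cosFun k p * F p ∂vol + ∫ p, sinFun k p * F p ∂vol = 0 := fun k => by
    rw [← integral_add (hc k) (hs k), ← h k]
    simp only [cas, add_mul]
  -- Passing to `-k` changes the sign of the sine only, which separates the two parts of `cas`.
  have h2 : ∀ k, ∫ p, cosFun k p * F p ∂vol - ∫ p, sinFun k p * F p ∂vol = 0 := fun k => by
    rw [← integral_sub (hc k) (hs k), ← h (-k)]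
    simp only [cas, add_mul, cosFun_neg, sinFun_neg, neg_mul, sub_eq_add_neg]
  have h3 : (fun p => (F p : ℂ)) = 0 := by
    refine eq_zero_of_integral_mul_char_eq_zero (Complex.continuous_ofReal.comp hF) fun k => ?_
    have e : (fun p => char k p * (F p : ℂ)) =
        fun p => ((cosFun k p * F p : ℝ) : ℂ) + ((sinFun k p * F p : ℝ) : ℂ) * Complex.I := by
      funext p
      apply Complex.ext <;> simp [cosFun, sinFun]
    rw [e, integral_add (hc k).ofReal ((hs k).ofReal.mul_const _), integral_mul_const,
      integral_complex_ofReal, integral_complex_ofReal]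
    have hcz : ∫ p, cosFun k p * F p ∂vol = 0 := by linarith [h1 k, h2 k]
    have hsz : ∫ p, sinFun k p * F p ∂vol = 0 := by linarith [h1 k, h2 k]
    simp [hcz, hsz]
  funext p
  have := congrFun h3 p
  simpa using this

end FlatTorus

open FlatTorus

variable {E : Type*} [NormedAddCommGroup E] [InnerProductSpace ℝ E]

/-! ### The `L²` pairing of sections and formal adjoints -/

namespace SphereMap

variable (φ : SphereMap E)

theorem Sections.continuous_inner (V W : φ.Sections) :
    Continuous fun p => (inner ℝ (V.1 p) (W.1 p) : ℝ) :=
  V.2.1.continuous.inner W.2.1.continuous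

/-- The `L²` pairing of sections. -/
def pairing : LinearMap.BilinForm ℝ φ.Sections :=
  LinearMap.mk₂ ℝ (fun V W => ∫ p, inner ℝ (V.1 p) (W.1 p) ∂vol)
    (fun V V' W => by
      simp only [Submodule.coe_add, Pi.add_apply, inner_add_left]
      exact integral_add (integrable_of_continuous (Sections.continuous_inner φ V W))
        (integrable_of_continuous (Sections.continuous_inner φ V' W)))
    (fun c V W => by
      simp only [Submodule.coe_smul, Pi.smul_apply, real_inner_smul_left, smul_eq_mul]
      exact integral_const_mul c _)
    (fun V W W' => by
      simp only [Submodule.coe_add, Pi.add_apply, inner_add_right]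
      exact integral_add (integrable_of_continuous (Sections.continuous_inner φ V W))
        (integrable_of_continuous (Sections.continuous_inner φ V W')))
    (fun c V W => by
      simp only [Submodule.coe_smul, Pi.smul_apply, real_inner_smul_right, smul_eq_mul]
      exact integral_const_mul c _)

theorem pairing_apply (V W : φ.Sections) :
    φ.pairing V W = ∫ p, inner ℝ (V.1 p) (W.1 p) ∂vol := rfl

theorem inner_tangProj_left {p : FlatTorus} (v : E) {w : E} (hw : inner ℝ (φ.incl p) w = 0) :
    inner ℝ (φ.tangProj p v) w = (inner ℝ v w : ℝ) := by
  simp [tangProj, inner_sub_left, real_inner_smul_left, hw]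

theorem nabla_apply (i : Fin 2) (V : φ.Sections) (p : FlatTorus) :
    (φ.nabla i V).1 p = φ.tangProj p (frameDeriv i V.1 p) := rfl

/-- The connection is metric, so that covariant derivatives along the frame are skew-adjoint. -/
theorem pairing_nabla_left (i : Fin 2) (V W : φ.Sections) :
    φ.pairing (φ.nabla i V) W = -φ.pairing V (φ.nabla i W) := by
  have hs : FlatTorus.Smooth fun p => (inner ℝ (V.1 p) (W.1 p) : ℝ) :=
    ContDiff.inner ℝ V.2.1 W.2.1
  have h := integral_frameDeriv hs i
  have e : ∀ p, frameDeriv i (fun q => (inner ℝ (V.1 q) (W.1 q) : ℝ)) p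
      = inner ℝ (V.1 p) ((φ.nabla i W).1 p) + inner ℝ ((φ.nabla i V).1 p) (W.1 p) := fun p => by
    rw [frameDeriv_inner V.2.1 W.2.1, nabla_apply, nabla_apply,
      inner_tangProj_left φ _ (W.2.2 p), real_inner_comm (φ.tangProj p _),
      inner_tangProj_left φ _ (V.2.2 p), real_inner_comm (V.1 p)]
  simp only [e] at h
  rw [integral_add (integrable_of_continuous (Sections.continuous_inner φ _ _))
    (integrable_of_continuous (Sections.continuous_inner φ _ _))] at h
  rw [pairing_apply, pairing_apply]
  linarith

theorem isAdjointPair_contract (A B : φ.Sections) :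
    LinearMap.IsAdjointPair φ.pairing φ.pairing (φ.contract A B) (φ.contract B A) := fun V W => by
  rw [pairing_apply, pairing_apply]
  refine integral_congr_ae (Filter.Eventually.of_forall fun p => ?_)
  change (inner ℝ ((inner ℝ (A.1 p) (V.1 p) : ℝ) • B.1 p) (W.1 p) : ℝ)
    = inner ℝ (V.1 p) ((inner ℝ (B.1 p) (W.1 p) : ℝ) • A.1 p)
  rw [real_inner_smul_left, real_inner_smul_right, real_inner_comm (A.1 p)]
  ring

/-- Multiplication of a section by a smooth function. -/
def smulFun (g : FlatTorus → ℝ) (hg : FlatTorus.Smooth g) (V : φ.Sections) : φ.Sections :=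
  ⟨fun p => g p • V.1 p, ContDiff.smul hg V.2.1, fun p => by
    rw [inner_smul_right, V.2.2 p, mul_zero]⟩

/-- Leibniz rule. -/
theorem nabla_smulFun (i : Fin 2) {g : FlatTorus → ℝ} (hg : FlatTorus.Smooth g) (V : φ.Sections) :
    φ.nabla i (φ.smulFun g hg V)
      = φ.smulFun g hg (φ.nabla i V) + φ.smulFun (frameDeriv i g) (hg.frameDeriv i) V := by
  refine Subtype.ext (funext fun p => ?_)
  change φ.tangProj p (frameDeriv i (fun q => g q • V.1 q) p)
    = g p • φ.tangProj p (frameDeriv i V.1 p) + frameDeriv i g p • V.1 p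
  rw [frameDeriv_smul_fun hg V.2.1]
  simp only [tangProj, inner_add_right, inner_smul_right, V.2.2 p]
  module

end SphereMap

/-! ### Derivatives in coordinates -/

namespace FlatTorus

theorem frameDeriv_zero_eq {E : Type*} [NormedAddCommGroup E] [NormedSpace ℝ E]
    {F : FlatTorus → E} {v : E} {x y : ℝ} (h : HasDerivAt (fun t => F (proj (t, y))) v x) :
    frameDeriv 0 F (proj (x, y)) = v := by
  have h' : HasDerivAt (fun t => F (proj (x + t, y))) v 0 :=
    HasDerivAt.comp_const_add x 0 (by simpa using h)
  rw [← h'.deriv]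
  simp [frameDeriv, ← proj_add, dir]

theorem frameDeriv_one_eq {E : Type*} [NormedAddCommGroup E] [NormedSpace ℝ E]
    {F : FlatTorus → E} {v : E} {x y : ℝ} (h : HasDerivAt (fun t => F (proj (x, t))) v y) :
    frameDeriv 1 F (proj (x, y)) = v := by
  have h' : HasDerivAt (fun t => F (proj (x, y + t))) v 0 :=
    HasDerivAt.comp_const_add y 0 (by simpa using h)
  rw [← h'.deriv]
  simp [frameDeriv, ← proj_add, dir]

theorem frameDeriv_coord {F : FlatTorus → EuclideanSpace ℂ (Fin 3)} (hF : Smooth F) (i : Fin 2)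
    (p : FlatTorus) (j : Fin 3) : frameDeriv i F p j = frameDeriv i (fun q => F q j) p :=
  (frameDeriv_clm_comp ((EuclideanSpace.proj (𝕜 := ℂ) j).restrictScalars ℝ) hF i p).symm

end FlatTorus

theorem hasDerivAt_exp_I_mul (x : ℝ) :
    HasDerivAt (fun t : ℝ => Complex.exp (Complex.I * t))
      (Complex.I * Complex.exp (Complex.I * x)) x := by
  have h := ((Complex.ofRealCLM.hasDerivAt (x := x)).const_mul Complex.I).cexp
  simpa [mul_comm] using h

theorem hasDerivAt_exp_neg_I_mul (x : ℝ) :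
    HasDerivAt (fun t : ℝ => Complex.exp (-(Complex.I * t)))
      (-Complex.I * Complex.exp (-(Complex.I * x))) x := by
  have h := ((Complex.ofRealCLM.hasDerivAt (x := x)).const_mul Complex.I).neg.cexp
  simpa [mul_comm] using h

theorem hasDerivAt_sin_sqrt_two_mul (y : ℝ) :
    HasDerivAt (fun t : ℝ => (Real.sin (Real.sqrt 2 * t) : ℂ))
      ((Real.sqrt 2 : ℂ) * (Real.cos (Real.sqrt 2 * y) : ℂ)) y := by
  have h := (((hasDerivAt_id y).const_mul (Real.sqrt 2)).sin).ofReal_comp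
  simpa [mul_comm] using h

theorem hasDerivAt_cos_sqrt_two_mul (y : ℝ) :
    HasDerivAt (fun t : ℝ => (Real.cos (Real.sqrt 2 * t) : ℂ))
      (-((Real.sqrt 2 : ℂ) * (Real.sin (Real.sqrt 2 * y) : ℂ))) y := by
  have h := (((hasDerivAt_id y).const_mul (Real.sqrt 2)).cos).ofReal_comp
  simpa [mul_comm] using h

theorem ofReal_sqrt_two_sq : ((Real.sqrt 2 : ℝ) : ℂ) ^ 2 = 2 := by
  exact_mod_cast Real.sq_sqrt (by norm_num : (0 : ℝ) ≤ 2)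

theorem ofReal_sqrt_two_ne_zero : ((Real.sqrt 2 : ℝ) : ℂ) ≠ 0 := by
  exact_mod_cast (by positivity : Real.sqrt 2 ≠ 0)

/-! ### The unitary frame along Sasahara's map -/

namespace Sasahara

/-- The first coordinate field `dφ(X₁)`, as a map into `ℂ³`. -/
def tangentOne : FlatTorus → EuclideanSpace ℂ (Fin 3) := frameDeriv 0 sasaharaFun

/-- The second coordinate field `dφ(X₂)`, as a map into `ℂ³`. -/
def tangentTwo : FlatTorus → EuclideanSpace ℂ (Fin 3) := frameDeriv 1 sasaharaFun

theorem smooth_tangentOne : Smooth tangentOne := sasaharaFun_smooth.frameDeriv 0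

theorem smooth_tangentTwo : Smooth tangentTwo := sasaharaFun_smooth.frameDeriv 1

theorem tangentOne_proj (x y : ℝ) :
    tangentOne (proj (x, y)) = ((1 / Real.sqrt 2 : ℝ) : ℂ) •
      !₂[Complex.I * Complex.exp (Complex.I * x),
        Complex.exp (-(Complex.I * x)) * (Real.sin (Real.sqrt 2 * y) : ℂ),
        Complex.exp (-(Complex.I * x)) * (Real.cos (Real.sqrt 2 * y) : ℂ)] := by
  ext j
  rw [tangentOne, frameDeriv_coord sasaharaFun_smooth]
  refine frameDeriv_zero_eq ?_
  simp only [sasaharaFun_proj]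
  fin_cases j
  · exact (hasDerivAt_exp_I_mul x).const_mul _
  · refine (((hasDerivAt_exp_neg_I_mul x).const_mul Complex.I).mul_const _).const_mul
      ((1 / Real.sqrt 2 : ℝ) : ℂ) |>.congr_deriv ?_
    simp [← mul_assoc]
  · refine (((hasDerivAt_exp_neg_I_mul x).const_mul Complex.I).mul_const _).const_mul
      ((1 / Real.sqrt 2 : ℝ) : ℂ) |>.congr_deriv ?_
    simp [← mul_assoc]

theorem tangentTwo_proj (x y : ℝ) :
    tangentTwo (proj (x, y)) =
      !₂[0, Complex.I * Complex.exp (-(Complex.I * x)) * (Real.cos (Real.sqrt 2 * y) : ℂ),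
        -(Complex.I * Complex.exp (-(Complex.I * x)) * (Real.sin (Real.sqrt 2 * y) : ℂ))] := by
  have hs := ofReal_sqrt_two_ne_zero
  ext j
  rw [tangentTwo, frameDeriv_coord sasaharaFun_smooth]
  refine frameDeriv_one_eq ?_
  simp only [sasaharaFun_proj]
  fin_cases j
  · exact hasDerivAt_const y (((1 / Real.sqrt 2 : ℝ) : ℂ) * Complex.exp (Complex.I * x))
  · refine ((hasDerivAt_sin_sqrt_two_mul y).const_mul _).const_mul
      ((1 / Real.sqrt 2 : ℝ) : ℂ) |>.congr_deriv ?_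
    simp
    field_simp
  · refine ((hasDerivAt_cos_sqrt_two_mul y).const_mul _).const_mul
      ((1 / Real.sqrt 2 : ℝ) : ℂ) |>.congr_deriv ?_
    simp
    field_simp

theorem frameDeriv_zero_tangentOne (p : FlatTorus) :
    frameDeriv 0 tangentOne p = -sasaharaFun p := by
  obtain ⟨⟨x, y⟩, rfl⟩ := proj_surjective p
  ext j
  rw [frameDeriv_coord smooth_tangentOne]
  refine frameDeriv_zero_eq ?_
  simp only [tangentOne_proj, sasaharaFun_proj]
  fin_cases j
  · refine ((hasDerivAt_exp_I_mul x).const_mul Complex.I).const_mul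
      ((1 / Real.sqrt 2 : ℝ) : ℂ) |>.congr_deriv ?_
    simp [← mul_assoc]
  · refine ((hasDerivAt_exp_neg_I_mul x).mul_const _).const_mul
      ((1 / Real.sqrt 2 : ℝ) : ℂ) |>.congr_deriv ?_
    simp
  · refine ((hasDerivAt_exp_neg_I_mul x).mul_const _).const_mul
      ((1 / Real.sqrt 2 : ℝ) : ℂ) |>.congr_deriv ?_
    simp

theorem frameDeriv_zero_tangentTwo (p : FlatTorus) :
    frameDeriv 0 tangentTwo p = -(Complex.I • tangentTwo p) := by
  obtain ⟨⟨x, y⟩, rfl⟩ := proj_surjective p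
  ext j
  rw [frameDeriv_coord smooth_tangentTwo]
  refine frameDeriv_zero_eq ?_
  simp only [tangentTwo_proj]
  fin_cases j
  · refine (hasDerivAt_const x _).congr_deriv ?_
    simp
  · refine (((hasDerivAt_exp_neg_I_mul x).const_mul Complex.I).mul_const _).congr_deriv ?_
    simp [← mul_assoc]
  · refine (((hasDerivAt_exp_neg_I_mul x).const_mul Complex.I).mul_const _).neg.congr_deriv ?_
    simp [← mul_assoc]

theorem frameDeriv_one_tangentOne (p : FlatTorus) :
    frameDeriv 1 tangentOne p = -(Complex.I • tangentTwo p) := by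
  have hs := ofReal_sqrt_two_ne_zero
  obtain ⟨⟨x, y⟩, rfl⟩ := proj_surjective p
  ext j
  rw [frameDeriv_coord smooth_tangentOne]
  refine frameDeriv_one_eq ?_
  simp only [tangentOne_proj, tangentTwo_proj]
  fin_cases j
  · refine (hasDerivAt_const y (((1 / Real.sqrt 2 : ℝ) : ℂ) *
      (Complex.I * Complex.exp (Complex.I * x)))).congr_deriv ?_
    simp
  · refine ((hasDerivAt_sin_sqrt_two_mul y).const_mul _).const_mul
      ((1 / Real.sqrt 2 : ℝ) : ℂ) |>.congr_deriv ?_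
    simp [← mul_assoc]
    field_simp
    exact Or.inl trivial
  · refine ((hasDerivAt_cos_sqrt_two_mul y).const_mul _).const_mul
      ((1 / Real.sqrt 2 : ℝ) : ℂ) |>.congr_deriv ?_
    simp [← mul_assoc]
    field_simp
    exact Or.inl trivial

theorem frameDeriv_one_tangentTwo (p : FlatTorus) :
    frameDeriv 1 tangentTwo p = -(Complex.I • tangentOne p) - sasaharaFun p := by
  have hs := ofReal_sqrt_two_ne_zero
  have hs2 := ofReal_sqrt_two_sq
  obtain ⟨⟨x, y⟩, rfl⟩ := proj_surjective p
  ext j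
  rw [frameDeriv_coord smooth_tangentTwo]
  refine frameDeriv_one_eq ?_
  simp only [tangentOne_proj, tangentTwo_proj, sasaharaFun_proj]
  fin_cases j
  · refine (hasDerivAt_const y _).congr_deriv ?_
    simp
    linear_combination ((Real.sqrt 2 : ℂ)⁻¹ * Complex.exp (Complex.I * x)) * Complex.I_sq
  · refine ((hasDerivAt_cos_sqrt_two_mul y).const_mul _).congr_deriv ?_
    simp
    field_simp
    linear_combination (-(Complex.sin (Real.sqrt 2 * y))) * hs2
  · refine ((hasDerivAt_sin_sqrt_two_mul y).const_mul _).neg.congr_deriv ?_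
    simp
    field_simp
    linear_combination (-(Complex.cos (Real.sqrt 2 * y))) * hs2

theorem real_inner_eq_re (u v : EuclideanSpace ℂ (Fin 3)) :
    (inner ℝ u v : ℝ) = (inner ℂ u v : ℂ).re := by
  simp only [PiLp.inner_apply, Complex.re_sum]
  rfl

/-- The values of `φ`, `dφ(X₁)`, `dφ(X₂)` form a unitary frame of `ℂ³`. -/
theorem orthonormal_frame (p : FlatTorus) :
    Orthonormal ℂ ![sasaharaFun p, tangentOne p, tangentTwo p] := by
  obtain ⟨⟨x, y⟩, rfl⟩ := proj_surjective p
  have h1 : (starRingEnd ℂ) (Complex.exp (Complex.I * x)) * Complex.exp (Complex.I * x) = 1 := by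
    rw [← Complex.exp_conj, ← Complex.exp_add]
    simp
  have h2 : (starRingEnd ℂ) (Complex.exp (-(Complex.I * x))) * Complex.exp (-(Complex.I * x))
      = 1 := by
    rw [← Complex.exp_conj, ← Complex.exp_add]
    simp
  have h3 : (Real.sin (Real.sqrt 2 * y) : ℂ) ^ 2 + (Real.cos (Real.sqrt 2 * y) : ℂ) ^ 2 = 1 := by
    exact_mod_cast Real.sin_sq_add_cos_sq (Real.sqrt 2 * y)
  have hs : ((1 / Real.sqrt 2 : ℝ) : ℂ) ^ 2 = 1 / 2 := by
    push_cast
    rw [div_pow, ofReal_sqrt_two_sq]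
    norm_num
  have hI := Complex.I_sq
  rw [orthonormal_iff_ite]
  rw [sasaharaFun_proj, tangentOne_proj, tangentTwo_proj]
  -- The Gram matrix now involves only polynomial relations between the exponentials, their
  -- conjugates, the sine, the cosine and the normalising factor.
  generalize ((1 / Real.sqrt 2 : ℝ)) = r at *
  generalize Real.sin (Real.sqrt 2 * y) = s at *
  generalize Real.cos (Real.sqrt 2 * y) = c at *
  generalize Complex.exp (Complex.I * x) = e at *
  generalize Complex.exp (-(Complex.I * x)) = e' at *
  intro i j
  fin_cases i <;> fin_cases j <;>
    simp [PiLp.inner_apply, Fin.sum_univ_three, -inner_self_eq_norm_sq_to_K] <;> grind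

theorem eq_zero_of_forall_inner_eq_zero {p : FlatTorus} {v : EuclideanSpace ℂ (Fin 3)}
    (h0 : inner ℂ (sasaharaFun p) v = 0) (h1 : inner ℂ (tangentOne p) v = 0)
    (h2 : inner ℂ (tangentTwo p) v = 0) : v = 0 := by
  have hc : Fintype.card (Fin 3) = Module.finrank ℂ (EuclideanSpace ℂ (Fin 3)) := by simp
  refine InnerProductSpace.ext_inner_left_basis
    (basisOfOrthonormalOfCardEqFinrank (orthonormal_frame p) hc) fun i => ?_
  rw [coe_basisOfOrthonormalOfCardEqFinrank, inner_zero_right]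
  fin_cases i
  · exact h0
  · exact h1
  · exact h2

theorem inner_frame (p : FlatTorus) :
    inner ℂ (sasaharaFun p) (sasaharaFun p) = 1 ∧ inner ℂ (tangentOne p) (tangentOne p) = 1 ∧
    inner ℂ (tangentTwo p) (tangentTwo p) = 1 ∧ inner ℂ (sasaharaFun p) (tangentOne p) = 0 ∧
    inner ℂ (sasaharaFun p) (tangentTwo p) = 0 ∧ inner ℂ (tangentOne p) (tangentTwo p) = 0 ∧
    inner ℂ (tangentOne p) (sasaharaFun p) = 0 ∧ inner ℂ (tangentTwo p) (sasaharaFun p) = 0 ∧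
    inner ℂ (tangentTwo p) (tangentOne p) = 0 := by
  have h := orthonormal_iff_ite.mp (orthonormal_frame p)
  exact ⟨h 0 0, h 1 1, h 2 2, h 0 1, h 0 2, h 1 2, h 1 0, h 2 0, h 2 1⟩

/-- Multiplication by `i` on `ℂ³`, as a real-linear map. -/
def mulI : EuclideanSpace ℂ (Fin 3) →L[ℝ] EuclideanSpace ℂ (Fin 3) :=
  ((Complex.I : ℂ) • ContinuousLinearMap.id ℂ (EuclideanSpace ℂ (Fin 3))).restrictScalars ℝ

theorem mulI_apply (v : EuclideanSpace ℂ (Fin 3)) : mulI v = Complex.I • v := rfl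

/-- The ambient values of the frame `X₁, X₂, iX₁, iX₂, iφ` of the pull-back bundle. -/
def frameFun : Fin 5 → FlatTorus → EuclideanSpace ℂ (Fin 3) :=
  ![tangentOne, tangentTwo, fun p => mulI (tangentOne p), fun p => mulI (tangentTwo p),
    fun p => mulI (sasaharaFun p)]

theorem smooth_frameFun (a : Fin 5) : Smooth (frameFun a) := by
  fin_cases a
  · exact smooth_tangentOne
  · exact smooth_tangentTwo
  · exact smooth_tangentOne.clm_comp mulI
  · exact smooth_tangentTwo.clm_comp mulI
  · exact sasaharaFun_smooth.clm_comp mulI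

theorem inner_sasaharaFun_frameFun (a : Fin 5) (p : FlatTorus) :
    (inner ℝ (sasaharaFun p) (frameFun a p) : ℝ) = 0 := by
  obtain ⟨h00, h11, h22, h01, h02, h12, h10, h20, h21⟩ := inner_frame p
  rw [real_inner_eq_re]
  fin_cases a <;> simp [frameFun, mulI_apply, h00, h01, h02,
    -inner_self_eq_norm_sq_to_K]

theorem inner_frameFun (a b : Fin 5) (p : FlatTorus) :
    (inner ℝ (frameFun a p) (frameFun b p) : ℝ) = if a = b then 1 else 0 := by
  obtain ⟨h00, h11, h22, h01, h02, h12, h10, h20, h21⟩ := inner_frame p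
  rw [real_inner_eq_re]
  fin_cases a <;> fin_cases b <;> simp [frameFun, mulI_apply, inner_smul_right, inner_smul_left,
    h00, h01, h02, h11, h12, h22, h10, h20, h21, -inner_self_eq_norm_sq_to_K]

/-- The parallel-coefficient orthonormal frame `X₁, X₂, iX₁, iX₂, iφ` of `φ⁻¹TS⁵`. -/
def frame (a : Fin 5) : sasahara.Sections :=
  ⟨frameFun a, smooth_frameFun a, fun p => inner_sasaharaFun_frameFun a p⟩

theorem frame_apply (a : Fin 5) (p : FlatTorus) : (frame a).1 p = frameFun a p := rfl

theorem inner_frame_frame (a b : Fin 5) (p : FlatTorus) :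
    (inner ℝ ((frame a).1 p) ((frame b).1 p) : ℝ) = if a = b then 1 else 0 :=
  inner_frameFun a b p

/-- The real products with a vector `u` and with `iu` give the real and imaginary parts of the
hermitian product with `u`. The one direction missing from the frame, `φ` itself, is covered by
tangency of `V`. -/
theorem eq_zero_of_inner_frame_eq_zero {V : sasahara.Sections}
    (h : ∀ a p, (inner ℝ ((frame a).1 p) (V.1 p) : ℝ) = 0) : V = 0 := by
  refine Subtype.ext (funext fun p => ?_)
  have h' : ∀ a, (inner ℂ (frameFun a p) (V.1 p)).re = 0 := fun a => by
    rw [← real_inner_eq_re]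
    exact h a p
  have hφ : (inner ℂ (sasaharaFun p) (V.1 p)).re = 0 := by
    rw [← real_inner_eq_re]
    exact V.2.2 p
  refine eq_zero_of_forall_inner_eq_zero (p := p) (Complex.ext hφ ?_)
    (Complex.ext (h' 0) ?_) (Complex.ext (h' 1) ?_)
  · simpa [frameFun, mulI_apply, inner_smul_left] using h' 4
  · simpa [frameFun, mulI_apply, inner_smul_left] using h' 2
  · simpa [frameFun, mulI_apply, inner_smul_left] using h' 3

/-! ### The connection and the iterated Jacobi operator in the frame -/

theorem dφ_zero : sasahara.dφ 0 = frame 0 := rfl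

theorem dφ_one : sasahara.dφ 1 = frame 1 := rfl

theorem frameDeriv_mulI {F : FlatTorus → EuclideanSpace ℂ (Fin 3)} (hF : Smooth F) (i : Fin 2)
    (p : FlatTorus) :
    frameDeriv i (fun q => mulI (F q)) p = Complex.I • frameDeriv i F p :=
  frameDeriv_clm_comp mulI hF i p

/-- The term `c • φ` is normal to the sphere and is removed by the tangential projection. -/
theorem nabla_eq_of_frameDeriv_eq {i : Fin 2} {V W : sasahara.Sections} (c : ℝ)
    (h : ∀ p, frameDeriv i V.1 p = W.1 p + c • sasaharaFun p) : sasahara.nabla i V = W := by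
  refine Subtype.ext (funext fun p => ?_)
  have hφ : (inner ℝ (sasahara.incl p) (sasaharaFun p) : ℝ) = 1 := sasahara.inner_incl_self p
  have hi : sasahara.incl p = sasaharaFun p := rfl
  rw [SphereMap.nabla_apply, h, SphereMap.tangProj, inner_add_right, inner_smul_right, W.2.2 p, hφ,
    hi]
  simp

theorem I_smul_I_smul (v : EuclideanSpace ℂ (Fin 3)) : Complex.I • Complex.I • v = -v := by
  rw [smul_smul, Complex.I_mul_I, neg_one_smul]

theorem frameDeriv_frameFun_mulI {F : FlatTorus → EuclideanSpace ℂ (Fin 3)} {a : Fin 5}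
    (ha : frameFun a = fun q => mulI (F q)) (hF : Smooth F) (i : Fin 2) (p : FlatTorus) :
    frameDeriv i (frame a).1 p = Complex.I • frameDeriv i F p := by
  have h : (frame a).1 = fun q => mulI (F q) := ha
  rw [h, frameDeriv_mulI hF]

/-- The connection in the frame, in the direction `X₁`. -/
theorem nabla_zero_frame :
    sasahara.nabla 0 (frame 0) = 0 ∧ sasahara.nabla 0 (frame 1) = -frame 3 ∧
    sasahara.nabla 0 (frame 2) = -frame 4 ∧ sasahara.nabla 0 (frame 3) = frame 1 ∧
    sasahara.nabla 0 (frame 4) = frame 2 := by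
  refine ⟨nabla_eq_of_frameDeriv_eq (-1) fun p => ?_, nabla_eq_of_frameDeriv_eq 0 fun p => ?_,
    nabla_eq_of_frameDeriv_eq 0 fun p => ?_, nabla_eq_of_frameDeriv_eq 0 fun p => ?_,
    nabla_eq_of_frameDeriv_eq 0 fun p => ?_⟩
  · refine (frameDeriv_zero_tangentOne p).trans ?_
    simp
  · refine (frameDeriv_zero_tangentTwo p).trans ?_
    simp [frame_apply, frameFun, mulI_apply]
  · rw [frameDeriv_frameFun_mulI rfl smooth_tangentOne, frameDeriv_zero_tangentOne]
    simp [frame_apply, frameFun, mulI_apply]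
  · rw [frameDeriv_frameFun_mulI rfl smooth_tangentTwo, frameDeriv_zero_tangentTwo, smul_neg,
      I_smul_I_smul]
    simp [frame_apply, frameFun]
  · rw [frameDeriv_frameFun_mulI rfl sasaharaFun_smooth]
    simp [frame_apply, frameFun, mulI_apply, tangentOne]

/-- The connection in the frame, in the direction `X₂`. -/
theorem nabla_one_frame :
    sasahara.nabla 1 (frame 0) = -frame 3 ∧ sasahara.nabla 1 (frame 1) = -frame 2 ∧
    sasahara.nabla 1 (frame 2) = frame 1 ∧ sasahara.nabla 1 (frame 3) = frame 0 - frame 4 ∧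
    sasahara.nabla 1 (frame 4) = frame 3 := by
  refine ⟨nabla_eq_of_frameDeriv_eq 0 fun p => ?_, nabla_eq_of_frameDeriv_eq (-1) fun p => ?_,
    nabla_eq_of_frameDeriv_eq 0 fun p => ?_, nabla_eq_of_frameDeriv_eq 0 fun p => ?_,
    nabla_eq_of_frameDeriv_eq 0 fun p => ?_⟩
  · refine (frameDeriv_one_tangentOne p).trans ?_
    simp [frame_apply, frameFun, mulI_apply]
  · refine (frameDeriv_one_tangentTwo p).trans ?_
    simp [frame_apply, frameFun, mulI_apply, sub_eq_add_neg]
  · rw [frameDeriv_frameFun_mulI rfl smooth_tangentOne, frameDeriv_one_tangentOne, smul_neg,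
      I_smul_I_smul]
    simp [frame_apply, frameFun]
  · rw [frameDeriv_frameFun_mulI rfl smooth_tangentTwo, frameDeriv_one_tangentTwo, smul_sub,
      smul_neg, I_smul_I_smul]
    simp [frame_apply, frameFun, mulI_apply]
  · rw [frameDeriv_frameFun_mulI rfl sasaharaFun_smooth]
    simp [frame_apply, frameFun, mulI_apply, tangentTwo]

theorem tension_eq : sasahara.tension = -frame 2 := by
  rw [SphereMap.tension, Fin.sum_univ_two, dφ_zero, dφ_one, nabla_zero_frame.1,
    nabla_one_frame.2.1, zero_add]

theorem scale_frame (a b : Fin 5) :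
    sasahara.scale (frame a) (frame b) = if a = b then 1 else 0 := by
  refine LinearMap.ext fun V => Subtype.ext (funext fun p => ?_)
  change (inner ℝ ((frame a).1 p) ((frame b).1 p) : ℝ) • V.1 p = _
  rw [inner_frame_frame]
  split_ifs <;> simp

theorem scale_neg_left (A B : sasahara.Sections) :
    sasahara.scale (-A) B = -sasahara.scale A B := by
  refine LinearMap.ext fun V => Subtype.ext (funext fun p => ?_)
  change (inner ℝ (-A.1 p) (B.1 p) : ℝ) • V.1 p = -((inner ℝ (A.1 p) (B.1 p) : ℝ) • V.1 p)
  rw [inner_neg_left, neg_smul]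

theorem scale_neg_right (A B : sasahara.Sections) :
    sasahara.scale A (-B) = -sasahara.scale A B := by
  refine LinearMap.ext fun V => Subtype.ext (funext fun p => ?_)
  change (inner ℝ (A.1 p) (-B.1 p) : ℝ) • V.1 p = -((inner ℝ (A.1 p) (B.1 p) : ℝ) • V.1 p)
  rw [inner_neg_right, neg_smul]

theorem contract_neg_left (A B : sasahara.Sections) :
    sasahara.contract (-A) B = -sasahara.contract A B := by
  refine LinearMap.ext fun V => Subtype.ext (funext fun p => ?_)
  change (inner ℝ (-A.1 p) (V.1 p) : ℝ) • B.1 p = -((inner ℝ (A.1 p) (V.1 p) : ℝ) • B.1 p)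
  rw [inner_neg_left, neg_smul]

theorem contract_neg_right (A B : sasahara.Sections) :
    sasahara.contract A (-B) = -sasahara.contract A B := by
  refine LinearMap.ext fun V => Subtype.ext (funext fun p => ?_)
  change (inner ℝ (A.1 p) (V.1 p) : ℝ) • (-B.1 p) = -((inner ℝ (A.1 p) (V.1 p) : ℝ) • B.1 p)
  rw [smul_neg]

/-- The elementary operator `V ↦ ⟨Eₐ, V⟩ E_b`. -/
def elem (a b : Fin 5) : Module.End ℝ sasahara.Sections := sasahara.contract (frame a) (frame b)

theorem contract_frame (a b : Fin 5) : sasahara.contract (frame a) (frame b) = elem a b := rfl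

/-- The iterated Jacobi operator in the frame. -/
theorem jacobi2_eq :
    sasahara.jacobi2 =
      sasahara.roughLaplacian * sasahara.roughLaplacian
        + sasahara.roughLaplacian * (elem 0 0 + elem 1 1)
        + (elem 0 0 + elem 1 1) * sasahara.roughLaplacian
        + (elem 0 0 + elem 1 1) * (elem 0 0 + elem 1 1)
        - (4 : ℝ) • sasahara.roughLaplacian
        - (4 : ℝ) • (elem 0 0 + elem 1 1)
        - (2 : ℝ) • (elem 4 0 - elem 1 1)
        - elem 2 2
        + (2 : ℝ) • (elem 2 0 * sasahara.nabla 0 + elem 2 1 * sasahara.nabla 1)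
        - (2 : ℝ) • (elem 0 2 * sasahara.nabla 0 + elem 1 2 * sasahara.nabla 1)
        + (3 : ℝ) • 1 := by
  have hn : sasahara.normSqDφ = (2 : ℝ) • 1 := by
    rw [SphereMap.normSqDφ, Fin.sum_univ_two, dφ_zero, dφ_one, scale_frame, scale_frame, if_pos rfl,
      if_pos rfl, two_smul]
  have ht : sasahara.traceDφ = elem 0 0 + elem 1 1 := by
    rw [SphereMap.traceDφ, Fin.sum_univ_two, dφ_zero, dφ_one]
    rfl
  -- Since `τ = -iX₁`, one has `∇₁τ = iφ` and `∇₂τ = -X₂`. With `|dφ|² = 2` and `|τ|² = 1` the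
  -- scalar terms add up to `-2 + 1 + 4 = 3`.
  have h0 : sasahara.nabla 0 (-frame 2) = frame 4 := by
    rw [map_neg, nabla_zero_frame.2.2.1, neg_neg]
  have h1 : sasahara.nabla 1 (-frame 2) = -frame 1 := by rw [map_neg, nabla_one_frame.2.2.1]
  rw [SphereMap.jacobi2, hn, ht, tension_eq]
  simp only [Fin.sum_univ_two, dφ_zero, dφ_one, h0, h1, scale_neg_left, scale_neg_right,
    contract_neg_left, contract_neg_right, scale_frame, contract_frame]
  simp only [show (4 : Fin 5) ≠ 0 by decide, if_true, if_false]
  refine LinearMap.ext fun V => ?_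
  simp only [LinearMap.add_apply, LinearMap.sub_apply, LinearMap.neg_apply, LinearMap.smul_apply,
    Module.End.mul_apply, Module.End.one_apply, LinearMap.zero_apply, map_add, map_sub, map_smul]
  module

/-! ### Modes and the symbol of the operator -/

/-- The frequency carried by the `a`-th frame field in the mode with index `k`: the fields `iX₁`
and `iX₂` carry the opposite frequency. -/
def modeIndex (a : Fin 5) (k : ℤ × ℤ) : ℤ × ℤ := ![k, k, -k, -k, k] a

theorem modeIndex_neg (a : Fin 5) (k : ℤ × ℤ) : modeIndex a (-k) = -modeIndex a k := by
  fin_cases a <;> rfl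

theorem modeIndex_modeIndex (a : Fin 5) (k : ℤ × ℤ) : modeIndex a (modeIndex a k) = k := by
  fin_cases a <;> simp [modeIndex]

theorem modeIndex_injective (a : Fin 5) : Function.Injective (modeIndex a) :=
  Function.LeftInverse.injective (modeIndex_modeIndex a)

/-- The symbol of the iterated Jacobi operator on the mode with frequencies `s`, `t`. -/
def symbol (s t : ℝ) : Matrix (Fin 5) (Fin 5) ℝ :=
  !![(s ^ 2 + t ^ 2) ^ 2 + 4 * t ^ 2, 4 * s * t, 0, 4 * t * (s ^ 2 + t ^ 2 + 1),
      -2 * s ^ 2 - 6 * t ^ 2;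
    4 * s * t, (s ^ 2 + t ^ 2) ^ 2 + 6 * (s ^ 2 + t ^ 2), 4 * t * (s ^ 2 + t ^ 2),
      4 * s * (s ^ 2 + t ^ 2 + 1), -8 * s * t;
    0, 4 * t * (s ^ 2 + t ^ 2), (s ^ 2 + t ^ 2) ^ 2 + 4 * (s ^ 2 + t ^ 2) - 4, 8 * s * t,
      -4 * s * (s ^ 2 + t ^ 2);
    4 * t * (s ^ 2 + t ^ 2 + 1), 4 * s * (s ^ 2 + t ^ 2 + 1), 8 * s * t,
      (s ^ 2 + t ^ 2) ^ 2 + 6 * s ^ 2 + 10 * t ^ 2, -4 * t * (s ^ 2 + t ^ 2 + 1);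
    -2 * s ^ 2 - 6 * t ^ 2, -8 * s * t, -4 * s * (s ^ 2 + t ^ 2), -4 * t * (s ^ 2 + t ^ 2 + 1),
      (s ^ 2 + t ^ 2) ^ 2 + 4 * (s ^ 2 + t ^ 2)]

theorem symbol_isSymm (s t : ℝ) : (symbol s t).IsSymm := by
  ext i j
  fin_cases i <;> fin_cases j <;> rfl

/-- The algebraic data from which the iterated Jacobi operator acts on modes: two derivations
`nabla`, elementary operators `elem a b` exchanging the frame fields, and mode vectors `e k a`. -/
structure ModeSystem (M : Type*) [AddCommGroup M] [Module ℝ M] where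
  /-- covariant derivatives -/
  nabla : Fin 2 → Module.End ℝ M
  /-- elementary operators `V ↦ ⟨Eₐ, V⟩ E_b` -/
  elem : Fin 5 → Fin 5 → Module.End ℝ M
  /-- mode vectors -/
  e : ℤ × ℤ → Fin 5 → M
  nabla_zero_zero : ∀ k, nabla 0 (e k 0) = freq 0 k • e (-k) 0
  nabla_zero_one : ∀ k, nabla 0 (e k 1) = -e (-k) 3 + freq 0 k • e (-k) 1
  nabla_zero_two : ∀ k, nabla 0 (e k 2) = -e (-k) 4 + (-freq 0 k) • e (-k) 2
  nabla_zero_three : ∀ k, nabla 0 (e k 3) = e (-k) 1 + (-freq 0 k) • e (-k) 3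
  nabla_zero_four : ∀ k, nabla 0 (e k 4) = e (-k) 2 + freq 0 k • e (-k) 4
  nabla_one_zero : ∀ k, nabla 1 (e k 0) = -e (-k) 3 + freq 1 k • e (-k) 0
  nabla_one_one : ∀ k, nabla 1 (e k 1) = -e (-k) 2 + freq 1 k • e (-k) 1
  nabla_one_two : ∀ k, nabla 1 (e k 2) = e (-k) 1 + (-freq 1 k) • e (-k) 2
  nabla_one_three : ∀ k, nabla 1 (e k 3) = e (-k) 0 - e (-k) 4 + (-freq 1 k) • e (-k) 3
  nabla_one_four : ∀ k, nabla 1 (e k 4) = e (-k) 3 + freq 1 k • e (-k) 4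
  elem_same : ∀ {a b : Fin 5}, modeIndex a = modeIndex b → ∀ k c,
    elem a b (e k c) = if a = c then e k b else 0
  elem_opposite : ∀ {a b : Fin 5}, (modeIndex a = fun k => modeIndex b (-k)) → ∀ k c,
    elem a b (e k c) = if a = c then e (-k) b else 0

namespace ModeSystem

variable {M : Type*} [AddCommGroup M] [Module ℝ M] (m : ModeSystem M)

/-- The rough Laplacian of a mode system. -/
def rough : Module.End ℝ M := -(m.nabla 0 * m.nabla 0 + m.nabla 1 * m.nabla 1)

/-- The part of the iterated Jacobi operator that is visibly symmetric. -/
def symmPart : Module.End ℝ M :=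
  m.rough * m.rough + m.rough * (m.elem 0 0 + m.elem 1 1) + (m.elem 0 0 + m.elem 1 1) * m.rough
    + (m.elem 0 0 + m.elem 1 1) * (m.elem 0 0 + m.elem 1 1) - (4 : ℝ) • m.rough
    - (4 : ℝ) • (m.elem 0 0 + m.elem 1 1) - m.elem 2 2 + (3 : ℝ) • 1

/-- The remaining terms of the iterated Jacobi operator. -/
def lowerPart : Module.End ℝ M :=
  (2 : ℝ) • (m.elem 2 0 * m.nabla 0 + m.elem 2 1 * m.nabla 1)
    - (2 : ℝ) • (m.elem 0 2 * m.nabla 0 + m.elem 1 2 * m.nabla 1)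
    - (2 : ℝ) • (m.elem 4 0 - m.elem 1 1)

/-- The formal adjoint of `lowerPart`. -/
def lowerPartAdjoint : Module.End ℝ M :=
  (2 : ℝ) • (-m.nabla 0 * m.elem 0 2 + -m.nabla 1 * m.elem 1 2)
    - (2 : ℝ) • (-m.nabla 0 * m.elem 2 0 + -m.nabla 1 * m.elem 2 1)
    - (2 : ℝ) • (m.elem 0 4 - m.elem 1 1)

theorem symmPart_add_lowerPart : m.symmPart + m.lowerPart =
      m.rough * m.rough + m.rough * (m.elem 0 0 + m.elem 1 1)
        + (m.elem 0 0 + m.elem 1 1) * m.rough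
        + (m.elem 0 0 + m.elem 1 1) * (m.elem 0 0 + m.elem 1 1)
        - (4 : ℝ) • m.rough
        - (4 : ℝ) • (m.elem 0 0 + m.elem 1 1)
        - (2 : ℝ) • (m.elem 4 0 - m.elem 1 1)
        - m.elem 2 2
        + (2 : ℝ) • (m.elem 2 0 * m.nabla 0 + m.elem 2 1 * m.nabla 1)
        - (2 : ℝ) • (m.elem 0 2 * m.nabla 0 + m.elem 1 2 * m.nabla 1)
        + (3 : ℝ) • 1 := by
  rw [symmPart, lowerPart]
  abel

/-- Each `∇`, and each elementary operator between the two groups of frame fields, turns mode `k`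
into mode `-k`. Every term contains an even number of such factors, so the result lies again in mode
`k`. -/
theorem symmPart_add_lowerPart_apply (k : ℤ × ℤ) (a : Fin 5) :
    (m.symmPart + m.lowerPart) (m.e k a)
      = ∑ b, symbol (freq 0 k) (freq 1 k) b a • m.e k b := by
  have h00 := m.elem_same (a := 0) (b := 0) rfl
  have h11 := m.elem_same (a := 1) (b := 1) rfl
  have h22 := m.elem_same (a := 2) (b := 2) rfl
  have h40 := m.elem_same (a := 4) (b := 0) rfl
  have h20 := m.elem_opposite (a := 2) (b := 0) rfl
  have h21 := m.elem_opposite (a := 2) (b := 1) rfl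
  have h02 := m.elem_opposite (a := 0) (b := 2) (funext fun k => by simp [modeIndex])
  have h12 := m.elem_opposite (a := 1) (b := 2) (funext fun k => by simp [modeIndex])
  rw [Fin.sum_univ_five, symmPart, lowerPart, rough]
  fin_cases a <;>
  · simp [nabla_zero_zero, nabla_zero_one, nabla_zero_two, nabla_zero_three, nabla_zero_four,
      nabla_one_zero, nabla_one_one, nabla_one_two, nabla_one_three, nabla_one_four, h00, h11,
      h22, h40, h20, h21, h02, h12,
      freq_neg, symbol]
    module

/-- Self-adjointness is needed only on modes, because `I₂` is moved across the pairing only onto a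
mode vector. There it is a finite check. -/
theorem lowerPartAdjoint_apply (k : ℤ × ℤ) (a : Fin 5) :
    m.lowerPartAdjoint (m.e k a) = m.lowerPart (m.e k a) := by
  have h11 := m.elem_same (a := 1) (b := 1) rfl
  have h40 := m.elem_same (a := 4) (b := 0) rfl
  have h04 := m.elem_same (a := 0) (b := 4) rfl
  have h20 := m.elem_opposite (a := 2) (b := 0) rfl
  have h21 := m.elem_opposite (a := 2) (b := 1) rfl
  have h02 := m.elem_opposite (a := 0) (b := 2) (funext fun k => by simp [modeIndex])
  have h12 := m.elem_opposite (a := 1) (b := 2) (funext fun k => by simp [modeIndex])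
  rw [lowerPart, lowerPartAdjoint]
  fin_cases a <;>
  · simp [nabla_zero_zero, nabla_zero_one, nabla_zero_two, nabla_zero_three, nabla_zero_four,
      nabla_one_zero, nabla_one_one, nabla_one_two, nabla_one_three, nabla_one_four, h11, h40,
      h04, h20, h21, h02, h12, freq_neg]
    try module

end ModeSystem

/-! ### The modes as sections -/

/-- The section `cas · Eₐ`, for the Hartley function attached to the mode `k`. -/
def modeField (k : ℤ × ℤ) (a : Fin 5) : sasahara.Sections :=
  sasahara.smulFun (cas (modeIndex a k)) (smooth_cas _) (frame a)

theorem modeField_apply (k : ℤ × ℤ) (a : Fin 5) (p : FlatTorus) :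
    (modeField k a).1 p = cas (modeIndex a k) p • frameFun a p := rfl

theorem smulFun_cas_frame {j k : ℤ × ℤ} {b : Fin 5} (h : j = modeIndex b k) :
    sasahara.smulFun (cas j) (smooth_cas j) (frame b) = modeField k b := by
  subst h
  rfl

theorem smulFun_neg {g : FlatTorus → ℝ} (hg : Smooth g) (V : sasahara.Sections) :
    sasahara.smulFun g hg (-V) = -sasahara.smulFun g hg V :=
  Subtype.ext (funext fun p => smul_neg (g p) (V.1 p))

theorem smulFun_sub {g : FlatTorus → ℝ} (hg : Smooth g) (V W : sasahara.Sections) :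
    sasahara.smulFun g hg (V - W) = sasahara.smulFun g hg V - sasahara.smulFun g hg W :=
  Subtype.ext (funext fun p => smul_sub (g p) (V.1 p) (W.1 p))

theorem smulFun_zero {g : FlatTorus → ℝ} (hg : Smooth g) :
    sasahara.smulFun g hg 0 = 0 :=
  Subtype.ext (funext fun p => smul_zero (g p))

theorem nabla_modeField (i : Fin 2) (k : ℤ × ℤ) (a : Fin 5) :
    sasahara.nabla i (modeField k a)
      = sasahara.smulFun (cas (modeIndex a k)) (smooth_cas _) (sasahara.nabla i (frame a))
        + freq i (modeIndex a k) • modeField (-k) a := by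
  rw [modeField, SphereMap.nabla_smulFun]
  congr 1
  refine Subtype.ext (funext fun p => ?_)
  change frameDeriv i (cas (modeIndex a k)) p • frameFun a p
    = freq i (modeIndex a k) • (modeField (-k) a).1 p
  rw [frameDeriv_cas, modeField_apply, modeIndex_neg, mul_smul]

theorem nabla_zero_modeField_zero (k : ℤ × ℤ) :
    sasahara.nabla 0 (modeField k 0) = freq 0 k • modeField (-k) 0 := by
  rw [nabla_modeField, nabla_zero_frame.1, smulFun_zero, zero_add]
  rfl

theorem nabla_zero_modeField_one (k : ℤ × ℤ) :
    sasahara.nabla 0 (modeField k 1) = -modeField (-k) 3 + freq 0 k • modeField (-k) 1 := by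
  rw [nabla_modeField, nabla_zero_frame.2.1, smulFun_neg,
    smulFun_cas_frame (k := -k) (by simp [modeIndex])]
  rfl

theorem nabla_zero_modeField_two (k : ℤ × ℤ) :
    sasahara.nabla 0 (modeField k 2) = -modeField (-k) 4 + (-freq 0 k) • modeField (-k) 2 := by
  rw [nabla_modeField, nabla_zero_frame.2.2.1, smulFun_neg,
    smulFun_cas_frame (k := -k) (by simp [modeIndex]), show modeIndex 2 k = -k from rfl, freq_neg]

theorem nabla_zero_modeField_three (k : ℤ × ℤ) :
    sasahara.nabla 0 (modeField k 3) = modeField (-k) 1 + (-freq 0 k) • modeField (-k) 3 := by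
  rw [nabla_modeField, nabla_zero_frame.2.2.2.1,
    smulFun_cas_frame (k := -k) (by simp [modeIndex]), show modeIndex 3 k = -k from rfl, freq_neg]

theorem nabla_zero_modeField_four (k : ℤ × ℤ) :
    sasahara.nabla 0 (modeField k 4) = modeField (-k) 2 + freq 0 k • modeField (-k) 4 := by
  rw [nabla_modeField, nabla_zero_frame.2.2.2.2,
    smulFun_cas_frame (k := -k) (by simp [modeIndex])]
  rfl

theorem nabla_one_modeField_zero (k : ℤ × ℤ) :
    sasahara.nabla 1 (modeField k 0) = -modeField (-k) 3 + freq 1 k • modeField (-k) 0 := by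
  rw [nabla_modeField, nabla_one_frame.1, smulFun_neg,
    smulFun_cas_frame (k := -k) (by simp [modeIndex])]
  rfl

theorem nabla_one_modeField_one (k : ℤ × ℤ) :
    sasahara.nabla 1 (modeField k 1) = -modeField (-k) 2 + freq 1 k • modeField (-k) 1 := by
  rw [nabla_modeField, nabla_one_frame.2.1, smulFun_neg,
    smulFun_cas_frame (k := -k) (by simp [modeIndex])]
  rfl

theorem nabla_one_modeField_two (k : ℤ × ℤ) :
    sasahara.nabla 1 (modeField k 2) = modeField (-k) 1 + (-freq 1 k) • modeField (-k) 2 := by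
  rw [nabla_modeField, nabla_one_frame.2.2.1,
    smulFun_cas_frame (k := -k) (by simp [modeIndex]), show modeIndex 2 k = -k from rfl, freq_neg]

theorem nabla_one_modeField_three (k : ℤ × ℤ) :
    sasahara.nabla 1 (modeField k 3)
      = modeField (-k) 0 - modeField (-k) 4 + (-freq 1 k) • modeField (-k) 3 := by
  rw [nabla_modeField, nabla_one_frame.2.2.2.1, smulFun_sub,
    smulFun_cas_frame (b := 0) (k := -k) (by simp [modeIndex]),
    smulFun_cas_frame (b := 4) (k := -k) (by simp [modeIndex]), show modeIndex 3 k = -k from rfl,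
    freq_neg]

theorem nabla_one_modeField_four (k : ℤ × ℤ) :
    sasahara.nabla 1 (modeField k 4) = modeField (-k) 3 + freq 1 k • modeField (-k) 4 := by
  rw [nabla_modeField, nabla_one_frame.2.2.2.2,
    smulFun_cas_frame (k := -k) (by simp [modeIndex])]
  rfl

/-- An elementary operator changes the frame field and keeps the Hartley function; `h` says which
label `j` carries that same function at `b`. -/
theorem elem_modeField {a b : Fin 5} {j k : ℤ × ℤ} (h : modeIndex a k = modeIndex b j)
    (c : Fin 5) : elem a b (modeField k c) = if a = c then modeField j b else 0 := by
  refine Subtype.ext (funext fun p => ?_)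
  change (inner ℝ (frameFun a p) (cas (modeIndex c k) p • frameFun c p) : ℝ) • frameFun b p = _
  rw [inner_smul_right, inner_frameFun]
  split_ifs with hac
  · subst hac
    rw [mul_one, h, modeField_apply]
  · rw [mul_zero, zero_smul]
    rfl

theorem elem_same_modeField {a b : Fin 5} (h : modeIndex a = modeIndex b) (k : ℤ × ℤ)
    (c : Fin 5) : elem a b (modeField k c) = if a = c then modeField k b else 0 :=
  elem_modeField (congrFun h k) c

theorem elem_opposite_modeField {a b : Fin 5} (h : modeIndex a = fun k => modeIndex b (-k))
    (k : ℤ × ℤ) (c : Fin 5) : elem a b (modeField k c) = if a = c then modeField (-k) b else 0 :=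
  elem_modeField (congrFun h k) c

/-- The symbol on the mode `k`. -/
def modeSymbol (k : ℤ × ℤ) : Matrix (Fin 5) (Fin 5) ℝ := symbol (freq 0 k) (freq 1 k)

/-- The mode system of Sasahara's map. -/
def modeSystem : ModeSystem sasahara.Sections where
  nabla := sasahara.nabla
  elem := elem
  e := modeField
  nabla_zero_zero := nabla_zero_modeField_zero
  nabla_zero_one := nabla_zero_modeField_one
  nabla_zero_two := nabla_zero_modeField_two
  nabla_zero_three := nabla_zero_modeField_three
  nabla_zero_four := nabla_zero_modeField_four
  nabla_one_zero := nabla_one_modeField_zero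
  nabla_one_one := nabla_one_modeField_one
  nabla_one_two := nabla_one_modeField_two
  nabla_one_three := nabla_one_modeField_three
  nabla_one_four := nabla_one_modeField_four
  elem_same := elem_same_modeField
  elem_opposite := elem_opposite_modeField

theorem jacobi2_eq_modeSystem :
    sasahara.jacobi2 = modeSystem.symmPart + modeSystem.lowerPart := by
  have hr : sasahara.roughLaplacian = modeSystem.rough := by
    rw [SphereMap.roughLaplacian, Fin.sum_univ_two]
    rfl
  rw [jacobi2_eq, hr]
  exact modeSystem.symmPart_add_lowerPart.symm

theorem jacobi2_modeField (k : ℤ × ℤ) (a : Fin 5) :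
    sasahara.jacobi2 (modeField k a) = ∑ b, modeSymbol k b a • modeField k b := by
  rw [jacobi2_eq_modeSystem]
  exact modeSystem.symmPart_add_lowerPart_apply k a

end Sasahara

/-! ### Reduction of eigenspaces to finite blocks -/

section ModeDecomposition

variable {ι M F : Type} [DecidableEq ι] [AddCommGroup M] [Module ℝ M] [AddCommGroup F]
  [Module ℝ F] [Module.Finite ℝ F]

/-- If an operator is decomposed into finite-dimensional blocks `L k` by a complete system of
coefficient maps, and only the blocks in a finite set have eigenvalue `μ`, then the eigenspace of
the operator is the sum of those of the blocks. -/
theorem rank_eigenspace_eq_sum {T : Module.End ℝ M} {L : ι → Module.End ℝ F}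
    {H : ι → M →ₗ[ℝ] F} {R : ι → F →ₗ[ℝ] M} (hH : ∀ k V, H k (T V) = L k (H k V))
    (hR : ∀ k v, T (R k v) = R k (L k v)) (hHR : ∀ k l v, H l (R k v) = if k = l then v else 0)
    (hinj : ∀ V, (∀ k, H k V = 0) → V = 0) {K : Finset ι} {μ : ℝ}
    (hK : ∀ k ∉ K, Module.finrank ℝ (Module.End.eigenspace (L k) μ) = 0) :
    Module.rank ℝ (Module.End.eigenspace T μ)
      = ((∑ k ∈ K, Module.finrank ℝ (Module.End.eigenspace (L k) μ) : ℕ) : Cardinal) := by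
  have hmem : ∀ k V, V ∈ Module.End.eigenspace T μ → H k V ∈ Module.End.eigenspace (L k) μ :=
    fun k V hV => by
      rw [Module.End.mem_eigenspace_iff] at hV ⊢
      rw [← hH, hV, map_smul]
  have hbot : ∀ k ∉ K, ∀ V ∈ Module.End.eigenspace T μ, H k V = 0 := fun k hk V hV => by
    have h := hmem k V hV
    rwa [Submodule.finrank_eq_zero.mp (hK k hk), Submodule.mem_bot] at h
  let Φ : Module.End.eigenspace T μ →ₗ[ℝ] ∀ k : K, Module.End.eigenspace (L k) μ :=
    LinearMap.pi fun k => ((H k).comp (Submodule.subtype _)).codRestrict _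
      fun V => hmem k V.1 V.2
  have hΦ : ∀ V k, (Φ V k : F) = H k V := fun V k => rfl
  -- Injectivity is completeness, since coefficients outside `K` vanish on the eigenspace;
  -- surjectivity comes from the finite sum of reconstructed blocks.
  have hbij : Function.Bijective Φ := by
    constructor
    · rw [← LinearMap.ker_eq_bot, LinearMap.ker_eq_bot']
      intro V hV
      refine Subtype.ext (hinj V.1 fun k => ?_)
      by_cases hk : k ∈ K
      · rw [← hΦ V ⟨k, hk⟩, hV]
        rfl
      · exact hbot k hk V.1 V.2
    · intro w
      refine ⟨⟨∑ k : K, R k (w k), Submodule.sum_mem _ fun k _ => ?_⟩, ?_⟩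
      · rw [Module.End.mem_eigenspace_iff, hR, Module.End.mem_eigenspace_iff.mp (w k).2, map_smul]
      · refine funext fun l => Subtype.ext ?_
        rw [hΦ]
        simp only [map_sum, hHR]
        rw [Finset.sum_eq_single l]
        · simp
        · intro k _ hk
          rw [if_neg fun h => hk (Subtype.ext h)]
        · simp
  have e := LinearEquiv.ofBijective Φ hbij
  rw [e.rank_eq, ← Module.finrank_eq_rank, Module.finrank_pi_fintype,
    Finset.sum_coe_sort K fun k => Module.finrank ℝ (Module.End.eigenspace (L k) μ)]

end ModeDecomposition

/-- A real symmetric matrix is semisimple, so geometric and algebraic multiplicities agree. This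
reduces the spectral count to roots of characteristic polynomials. -/
theorem finrank_eigenspace_toEuclideanLin {n : Type*} [Fintype n] [DecidableEq n]
    {A : Matrix n n ℝ} (hA : A.IsSymm) (μ : ℝ) :
    Module.finrank ℝ (Module.End.eigenspace (Matrix.toEuclideanLin A) μ)
      = A.charpoly.rootMultiplicity μ := by
  have hs : (Matrix.toEuclideanLin A).IsSymmetric :=
    Matrix.isSymmetric_toEuclideanLin_iff.mpr (by
      rw [Matrix.IsHermitian, Matrix.conjTranspose_eq_transpose_of_trivial]
      exact hA)
  rw [← hs.isFinitelySemisimple.maxGenEigenspace_eq_eigenspace,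
    LinearMap.finrank_maxGenEigenspace_eq, Matrix.toEuclideanLin_eq_toLin_orthonormal,
    Matrix.charpoly_toLin]

namespace Sasahara

namespace ModeSystem

variable {M : Type*} [AddCommGroup M] [Module ℝ M] (m : ModeSystem M)

/-- Skew-adjointness of `∇` makes the rough Laplacian symmetric, and the mixed terms of `symmPart`
occur in adjoint pairs; only `lowerPart` has to be replaced by its adjoint. -/
theorem apply_symmPart_add_lowerPart (B : LinearMap.BilinForm ℝ M)
    (hn : ∀ i x y, B (m.nabla i x) y = -B x (m.nabla i y))
    (he : ∀ a b x y, B (m.elem a b x) y = B x (m.elem b a y)) (x y : M) :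
    B x ((m.symmPart + m.lowerPart) y) = B ((m.symmPart + m.lowerPartAdjoint) x) y := by
  simp [symmPart, lowerPart, lowerPartAdjoint, rough, hn, he]
  ring

end ModeSystem

/-- A general section is not a finite combination of modes, so the action of `I₂` on its
coefficients is found by transferring `I₂` to the mode vector. -/
theorem pairing_jacobi2 (k : ℤ × ℤ) (a : Fin 5) (V : sasahara.Sections) :
    sasahara.pairing (modeField k a) (sasahara.jacobi2 V)
      = ∑ b, modeSymbol k a b * sasahara.pairing (modeField k b) V := by
  have h : (modeSystem.symmPart + modeSystem.lowerPartAdjoint) (modeField k a)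
      = ∑ b, modeSymbol k b a • modeField k b := by
    rw [← jacobi2_modeField, jacobi2_eq_modeSystem]
    exact congrArg (fun W => modeSystem.symmPart (modeField k a) + W)
      (modeSystem.lowerPartAdjoint_apply k a)
  rw [jacobi2_eq_modeSystem, modeSystem.apply_symmPart_add_lowerPart sasahara.pairing
    sasahara.pairing_nabla_left fun a b => sasahara.isAdjointPair_contract _ _, h, map_sum,
    LinearMap.sum_apply]
  refine Finset.sum_congr rfl fun b _ => ?_
  rw [map_smul, LinearMap.smul_apply, smul_eq_mul, modeSymbol, (symbol_isSymm _ _).apply]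

theorem pairing_modeField (k l : ℤ × ℤ) (a b : Fin 5) :
    sasahara.pairing (modeField l a) (modeField k b) = if k = l ∧ a = b then 1 else 0 := by
  rw [SphereMap.pairing_apply]
  have h : ∀ p, (inner ℝ ((modeField l a).1 p) ((modeField k b).1 p) : ℝ)
      = (cas (modeIndex a l) p * cas (modeIndex b k) p) * if a = b then 1 else 0 := fun p => by
    rw [modeField_apply, modeField_apply, real_inner_smul_left, real_inner_smul_right,
      inner_frameFun, mul_assoc]
  simp only [h]
  rw [integral_mul_const, integral_cas_mul_cas]
  by_cases hab : a = b
  · subst hab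
    simp [(modeIndex_injective a).eq_iff, eq_comm]
  · simp [hab]

theorem eq_zero_of_pairing_modeField_eq_zero {V : sasahara.Sections}
    (h : ∀ k a, sasahara.pairing (modeField k a) V = 0) : V = 0 := by
  refine eq_zero_of_inner_frame_eq_zero fun a => congrFun ?_
  refine eq_zero_of_integral_mul_cas_eq_zero
    (SphereMap.Sections.continuous_inner sasahara (frame a) V) fun k => ?_
  -- `modeIndex a` is an involution, so every Hartley function occurs with the frame field `a`.
  rw [← h (modeIndex a k) a, SphereMap.pairing_apply]
  refine integral_congr_ae (Filter.Eventually.of_forall fun p => ?_)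
  simp only [modeField_apply, modeIndex_modeIndex, real_inner_smul_left, frame_apply]

/-- The coefficients of a section in the mode `k`. -/
def coeff (k : ℤ × ℤ) : sasahara.Sections →ₗ[ℝ] EuclideanSpace ℝ (Fin 5) :=
  (WithLp.linearEquiv 2 ℝ (Fin 5 → ℝ)).symm.toLinearMap.comp
    (LinearMap.pi fun a => sasahara.pairing (modeField k a))

/-- The section in the mode `k` with given coefficients. -/
def modeSection (k : ℤ × ℤ) : EuclideanSpace ℝ (Fin 5) →ₗ[ℝ] sasahara.Sections :=
  (Fintype.linearCombination ℝ (modeField k)).comp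
    (WithLp.linearEquiv 2 ℝ (Fin 5 → ℝ)).toLinearMap

theorem coeff_apply (k : ℤ × ℤ) (V : sasahara.Sections) (a : Fin 5) :
    coeff k V a = sasahara.pairing (modeField k a) V := rfl

theorem modeSection_apply (k : ℤ × ℤ) (v : EuclideanSpace ℝ (Fin 5)) :
    modeSection k v = ∑ a, v a • modeField k a := rfl

theorem rank_eigenspace_jacobi2 {K : Finset (ℤ × ℤ)} {μ : ℝ}
    (hK : ∀ k ∉ K, (modeSymbol k).charpoly.rootMultiplicity μ = 0) :
    Module.rank ℝ (Module.End.eigenspace sasahara.jacobi2 μ)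
      = ((∑ k ∈ K, (modeSymbol k).charpoly.rootMultiplicity μ : ℕ) : Cardinal) := by
  have hf : ∀ k, Module.finrank ℝ
      (Module.End.eigenspace (Matrix.toEuclideanLin (modeSymbol k)) μ)
        = (modeSymbol k).charpoly.rootMultiplicity μ :=
    fun k => finrank_eigenspace_toEuclideanLin (symbol_isSymm _ _) μ
  simp only [← hf] at hK ⊢
  refine rank_eigenspace_eq_sum (H := coeff) (R := modeSection) (fun k V => ?_) (fun k v => ?_)
    (fun k l v => ?_) (fun V hV => ?_) hK
  · ext a
    rw [coeff_apply, pairing_jacobi2]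
    rfl
  · rw [modeSection_apply, modeSection_apply, map_sum]
    simp only [map_smul, jacobi2_modeField, Finset.smul_sum]
    rw [Finset.sum_comm]
    refine Finset.sum_congr rfl fun b _ => ?_
    have hb : Matrix.toEuclideanLin (modeSymbol k) v b = ∑ a, modeSymbol k b a * v a := rfl
    rw [hb, Finset.sum_smul]
    exact Finset.sum_congr rfl fun a _ => by rw [smul_smul, mul_comm]
  · ext a
    rw [coeff_apply, modeSection_apply, map_sum]
    simp only [map_smul, pairing_modeField]
    split_ifs with h <;> simp [h]
  · exact eq_zero_of_pairing_modeField_eq_zero fun k a => 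
      congrArg (fun w : EuclideanSpace ℝ (Fin 5) => w a) (hV k)

/-! ### The determinant of the shifted symbol and its positivity -/

/-- The coefficient of `y ^ 0` in the determinant of `y + symbol s t`, for `p = s ^ 2`
and `r = t ^ 2`. -/
def detCoeffZero (p r : ℝ) : ℝ :=
  p ^ 10 + 10 * p ^ 9 * r - 12 * p ^ 9 + 45 * p ^ 8 * r ^ 2 - 116 * p ^ 8 * r + 44 * p ^ 8 + 120
    * p ^ 7 * r ^ 3 - 496 * p ^ 7 * r ^ 2 + 328 * p ^ 7 * r - 112 * p ^ 7 + 210 * p ^ 6 * r ^ 4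
    - 1232 * p ^ 6 * r ^ 3 + 1208 * p ^ 6 * r ^ 2 + 288 * p ^ 6 * r + 304 * p ^ 6 + 252 * p ^ 5
    * r ^ 5 - 1960 * p ^ 5 * r ^ 4 + 2824 * p ^ 5 * r ^ 3 + 2864 * p ^ 5 * r ^ 2 - 2528 * p ^ 5
    * r - 320 * p ^ 5 + 210 * p ^ 4 * r ^ 6 - 2072 * p ^ 4 * r ^ 5 + 4400 * p ^ 4 * r ^ 4 + 5568
    * p ^ 4 * r ^ 3 - 10288 * p ^ 4 * r ^ 2 - 960 * p ^ 4 * r + 576 * p ^ 4 + 120 * p ^ 3 * r ^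
    7 - 1456 * p ^ 3 * r ^ 6 + 4504 * p ^ 3 * r ^ 5 + 3312 * p ^ 3 * r ^ 4 - 14528 * p ^ 3 * r ^
    3 - 5376 * p ^ 3 * r ^ 2 + 1664 * p ^ 3 * r - 256 * p ^ 3 + 45 * p ^ 2 * r ^ 8 - 656 * p ^ 2
    * r ^ 7 + 2888 * p ^ 2 * r ^ 6 - 1504 * p ^ 2 * r ^ 5 - 7600 * p ^ 2 * r ^ 4 - 2816 * p ^ 2
    * r ^ 3 + 2816 * p ^ 2 * r ^ 2 + 512 * p ^ 2 * r + 10 * p * r ^ 9 - 172 * p * r ^ 8 + 1048 *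
    p * r ^ 7 - 2480 * p * r ^ 6 + 1696 * p * r ^ 5 - 1984 * p * r ^ 4 + 5504 * p * r ^ 3 - 768
    * p * r ^ 2 + r ^ 10 - 20 * r ^ 9 + 164 * r ^ 8 - 768 * r ^ 7 + 2224 * r ^ 6 - 3904 * r ^ 5
    + 3776 * r ^ 4 - 1536 * r ^ 3

/-- The coefficient of `y ^ 1` in the determinant of `y + symbol s t`, for `p = s ^ 2`
and `r = t ^ 2`. -/
def detCoeffOne (p r : ℝ) : ℝ :=
  5 * p ^ 8 + 40 * p ^ 7 * r - 16 * p ^ 7 + 140 * p ^ 6 * r ^ 2 - 128 * p ^ 6 * r - 64 * p ^ 6 +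
    280 * p ^ 5 * r ^ 3 - 432 * p ^ 5 * r ^ 2 + 280 * p ^ 5 * r - 48 * p ^ 5 + 350 * p ^ 4 * r ^
    4 - 800 * p ^ 4 * r ^ 3 + 1768 * p ^ 4 * r ^ 2 - 768 * p ^ 4 * r - 272 * p ^ 4 + 280 * p ^ 3
    * r ^ 5 - 880 * p ^ 3 * r ^ 4 + 2992 * p ^ 3 * r ^ 3 - 1568 * p ^ 3 * r ^ 2 - 3040 * p ^ 3 *
    r + 64 * p ^ 3 + 140 * p ^ 2 * r ^ 6 - 576 * p ^ 2 * r ^ 5 + 2128 * p ^ 2 * r ^ 4 - 576 * p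
    ^ 2 * r ^ 3 - 3200 * p ^ 2 * r ^ 2 + 256 * p ^ 2 + 40 * p * r ^ 7 - 208 * p * r ^ 6 + 568 *
    p * r ^ 5 + 720 * p * r ^ 4 - 5664 * p * r ^ 3 + 1472 * p * r ^ 2 - 256 * p * r + 5 * r ^ 8
    - 32 * r ^ 7 + 8 * r ^ 6 + 448 * r ^ 5 - 1136 * r ^ 4 + 512 * r ^ 3 + 512 * r ^ 2

/-- The coefficient of `y ^ 2` in the determinant of `y + symbol s t`, for `p = s ^ 2`
and `r = t ^ 2`. -/
def detCoeffTwo (p r : ℝ) : ℝ :=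
  10 * p ^ 6 + 60 * p ^ 5 * r + 24 * p ^ 5 + 150 * p ^ 4 * r ^ 2 + 120 * p ^ 4 * r - 8 * p ^ 4 +
    200 * p ^ 3 * r ^ 3 + 240 * p ^ 3 * r ^ 2 + 600 * p ^ 3 * r - 16 * p ^ 3 + 150 * p ^ 2 * r ^
    4 + 240 * p ^ 2 * r ^ 3 + 1256 * p ^ 2 * r ^ 2 - 160 * p ^ 2 * r - 320 * p ^ 2 + 60 * p * r
    ^ 5 + 120 * p * r ^ 4 + 680 * p * r ^ 3 - 592 * p * r ^ 2 - 416 * p * r + 64 * p + 10 * r ^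
    6 + 24 * r ^ 5 + 32 * r ^ 4 + 64 * r ^ 3 - 672 * r ^ 2 + 128 * r

/-- The coefficient of `y ^ 3` in the determinant of `y + symbol s t`, for `p = s ^ 2`
and `r = t ^ 2`. -/
def detCoeffThree (p r : ℝ) : ℝ :=
  10 * p ^ 4 + 40 * p ^ 3 * r + 48 * p ^ 3 + 60 * p ^ 2 * r ^ 2 + 160 * p ^ 2 * r + 96 * p ^ 2 +
    40 * p * r ^ 3 + 176 * p * r ^ 2 + 136 * p * r - 80 * p + 10 * r ^ 4 + 64 * r ^ 3 + 184 * r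
    ^ 2 - 128 * r

/-- The coefficient of `y ^ 4` in the determinant of `y + symbol s t`, for `p = s ^ 2`
and `r = t ^ 2`. -/
def detCoeffFour (p r : ℝ) : ℝ :=
  5 * p ^ 2 + 10 * p * r + 20 * p + 5 * r ^ 2 + 28 * r - 4

/-- The determinant of `y + symbol s t` in terms of `p = s ^ 2` and `r = t ^ 2`. -/
def symbolDet (p r y : ℝ) : ℝ :=
  y ^ 5 + detCoeffFour p r * y ^ 4 + detCoeffThree p r * y ^ 3 + detCoeffTwo p r * y ^ 2
    + detCoeffOne p r * y + detCoeffZero p r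

-- Only squares survive: replacing `s` by `-s` conjugates the symbol by `diag(1,-1,-1,1,1)`, and
-- replacing `t` by `-t` conjugates it by `diag(1,-1,1,-1,1)`.
set_option maxHeartbeats 1000000 in
theorem det_add_symbol (s t y : ℝ) :
    (Matrix.scalar (Fin 5) y + symbol s t).det = symbolDet (s ^ 2) (t ^ 2) y := by
  simp [symbol, symbolDet, detCoeffZero, detCoeffOne, detCoeffTwo, detCoeffThree, detCoeffFour,
    Matrix.det_succ_row_zero, Fin.sum_univ_succ, Fin.succAbove,
    Matrix.scalar_apply, Matrix.diagonal_apply]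
  ring

/-- In this and the following bounds, shifting the variables to the corner of the region leaves a
polynomial with positive coefficients. As `p = m²` and `r = 2n²`, the thresholds mean `|m| ≥ 3`,
then `|n| ≥ 3`, then `|m| ≥ 1` with `|n| ≥ 2`. -/
theorem detCoeffZero_pos_of_nine_le {p r : ℝ} (hp : 9 ≤ p) (hr : 0 ≤ r) :
    0 < detCoeffZero p r := by
  obtain ⟨a, ha, rfl⟩ : ∃ a, 0 ≤ a ∧ p = 9 + a := ⟨p - 9, by linarith, by ring⟩
  unfold detCoeffZero
  ring_nf
  positivity

theorem detCoeffOne_pos_of_nine_le {p r : ℝ} (hp : 9 ≤ p) (hr : 0 ≤ r) :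
    0 < detCoeffOne p r := by
  obtain ⟨a, ha, rfl⟩ : ∃ a, 0 ≤ a ∧ p = 9 + a := ⟨p - 9, by linarith, by ring⟩
  unfold detCoeffOne
  ring_nf
  positivity

theorem detCoeffTwo_pos_of_nine_le {p r : ℝ} (hp : 9 ≤ p) (hr : 0 ≤ r) :
    0 < detCoeffTwo p r := by
  obtain ⟨a, ha, rfl⟩ : ∃ a, 0 ≤ a ∧ p = 9 + a := ⟨p - 9, by linarith, by ring⟩
  unfold detCoeffTwo
  ring_nf
  positivity

theorem detCoeffThree_pos_of_nine_le {p r : ℝ} (hp : 9 ≤ p) (hr : 0 ≤ r) :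
    0 < detCoeffThree p r := by
  obtain ⟨a, ha, rfl⟩ : ∃ a, 0 ≤ a ∧ p = 9 + a := ⟨p - 9, by linarith, by ring⟩
  unfold detCoeffThree
  ring_nf
  positivity

theorem detCoeffFour_pos_of_nine_le {p r : ℝ} (hp : 9 ≤ p) (hr : 0 ≤ r) :
    0 < detCoeffFour p r := by
  obtain ⟨a, ha, rfl⟩ : ∃ a, 0 ≤ a ∧ p = 9 + a := ⟨p - 9, by linarith, by ring⟩
  unfold detCoeffFour
  ring_nf
  positivity

theorem detCoeffZero_pos_of_eighteen_le {p r : ℝ} (hr : 18 ≤ r) (hp : 0 ≤ p) :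
    0 < detCoeffZero p r := by
  obtain ⟨a, ha, rfl⟩ : ∃ a, 0 ≤ a ∧ r = 18 + a := ⟨r - 18, by linarith, by ring⟩
  unfold detCoeffZero
  ring_nf
  positivity

theorem detCoeffOne_pos_of_eighteen_le {p r : ℝ} (hr : 18 ≤ r) (hp : 0 ≤ p) :
    0 < detCoeffOne p r := by
  obtain ⟨a, ha, rfl⟩ : ∃ a, 0 ≤ a ∧ r = 18 + a := ⟨r - 18, by linarith, by ring⟩
  unfold detCoeffOne
  ring_nf
  positivity

theorem detCoeffTwo_pos_of_eighteen_le {p r : ℝ} (hr : 18 ≤ r) (hp : 0 ≤ p) :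
    0 < detCoeffTwo p r := by
  obtain ⟨a, ha, rfl⟩ : ∃ a, 0 ≤ a ∧ r = 18 + a := ⟨r - 18, by linarith, by ring⟩
  unfold detCoeffTwo
  ring_nf
  positivity

theorem detCoeffThree_pos_of_eighteen_le {p r : ℝ} (hr : 18 ≤ r) (hp : 0 ≤ p) :
    0 < detCoeffThree p r := by
  obtain ⟨a, ha, rfl⟩ : ∃ a, 0 ≤ a ∧ r = 18 + a := ⟨r - 18, by linarith, by ring⟩
  unfold detCoeffThree
  ring_nf
  positivity

theorem detCoeffFour_pos_of_eighteen_le {p r : ℝ} (hr : 18 ≤ r) (hp : 0 ≤ p) :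
    0 < detCoeffFour p r := by
  obtain ⟨a, ha, rfl⟩ : ∃ a, 0 ≤ a ∧ r = 18 + a := ⟨r - 18, by linarith, by ring⟩
  unfold detCoeffFour
  ring_nf
  positivity

theorem detCoeffZero_pos_of_one_le_of_eight_le {p r : ℝ} (hp : 1 ≤ p) (hr : 8 ≤ r) :
    0 < detCoeffZero p r := by
  obtain ⟨a, ha, rfl⟩ : ∃ a, 0 ≤ a ∧ p = 1 + a := ⟨p - 1, by linarith, by ring⟩
  obtain ⟨b, hb, rfl⟩ : ∃ b, 0 ≤ b ∧ r = 8 + b := ⟨r - 8, by linarith, by ring⟩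
  unfold detCoeffZero
  ring_nf
  positivity

theorem detCoeffOne_pos_of_one_le_of_eight_le {p r : ℝ} (hp : 1 ≤ p) (hr : 8 ≤ r) :
    0 < detCoeffOne p r := by
  obtain ⟨a, ha, rfl⟩ : ∃ a, 0 ≤ a ∧ p = 1 + a := ⟨p - 1, by linarith, by ring⟩
  obtain ⟨b, hb, rfl⟩ : ∃ b, 0 ≤ b ∧ r = 8 + b := ⟨r - 8, by linarith, by ring⟩
  unfold detCoeffOne
  ring_nf
  positivity

theorem detCoeffTwo_pos_of_one_le_of_eight_le {p r : ℝ} (hp : 1 ≤ p) (hr : 8 ≤ r) :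
    0 < detCoeffTwo p r := by
  obtain ⟨a, ha, rfl⟩ : ∃ a, 0 ≤ a ∧ p = 1 + a := ⟨p - 1, by linarith, by ring⟩
  obtain ⟨b, hb, rfl⟩ : ∃ b, 0 ≤ b ∧ r = 8 + b := ⟨r - 8, by linarith, by ring⟩
  unfold detCoeffTwo
  ring_nf
  positivity

theorem detCoeffThree_pos_of_one_le_of_eight_le {p r : ℝ} (hp : 1 ≤ p) (hr : 8 ≤ r) :
    0 < detCoeffThree p r := by
  obtain ⟨a, ha, rfl⟩ : ∃ a, 0 ≤ a ∧ p = 1 + a := ⟨p - 1, by linarith, by ring⟩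
  obtain ⟨b, hb, rfl⟩ : ∃ b, 0 ≤ b ∧ r = 8 + b := ⟨r - 8, by linarith, by ring⟩
  unfold detCoeffThree
  ring_nf
  positivity

theorem detCoeffFour_pos_of_one_le_of_eight_le {p r : ℝ} (hp : 1 ≤ p) (hr : 8 ≤ r) :
    0 < detCoeffFour p r := by
  obtain ⟨a, ha, rfl⟩ : ∃ a, 0 ≤ a ∧ p = 1 + a := ⟨p - 1, by linarith, by ring⟩
  obtain ⟨b, hb, rfl⟩ : ∃ b, 0 ≤ b ∧ r = 8 + b := ⟨r - 8, by linarith, by ring⟩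
  unfold detCoeffFour
  ring_nf
  positivity

/-- Excludes eigenvalues `-y ≤ 0` for all but finitely many modes. -/
theorem symbolDet_pos {p r y : ℝ} (hp : 0 ≤ p) (hr : 0 ≤ r) (hy : 0 ≤ y)
    (h : 9 ≤ p ∨ 18 ≤ r ∨ 1 ≤ p ∧ 8 ≤ r) : 0 < symbolDet p r y := by
  unfold symbolDet
  rcases h with h | h | ⟨h, h'⟩
  · have h0 := detCoeffZero_pos_of_nine_le h hr
    have h1 := detCoeffOne_pos_of_nine_le h hr
    have h2 := detCoeffTwo_pos_of_nine_le h hr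
    have h3 := detCoeffThree_pos_of_nine_le h hr
    have h4 := detCoeffFour_pos_of_nine_le h hr
    positivity
  · have h0 := detCoeffZero_pos_of_eighteen_le h hp
    have h1 := detCoeffOne_pos_of_eighteen_le h hp
    have h2 := detCoeffTwo_pos_of_eighteen_le h hp
    have h3 := detCoeffThree_pos_of_eighteen_le h hp
    have h4 := detCoeffFour_pos_of_eighteen_le h hp
    positivity
  · have h0 := detCoeffZero_pos_of_one_le_of_eight_le h h'
    have h1 := detCoeffOne_pos_of_one_le_of_eight_le h h'
    have h2 := detCoeffTwo_pos_of_one_le_of_eight_le h h'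
    have h3 := detCoeffThree_pos_of_one_le_of_eight_le h h'
    have h4 := detCoeffFour_pos_of_one_le_of_eight_le h h'
    positivity

/-! ### Nonpositive roots of the characteristic polynomials -/

open Polynomial in
theorem eval_charpoly_symbol (s t x : ℝ) :
    (symbol s t).charpoly.eval x = -symbolDet (s ^ 2) (t ^ 2) (-x) := by
  have h : Matrix.scalar (Fin 5) x - symbol s t
      = -(Matrix.scalar (Fin 5) (-x) + symbol s t) := by
    rw [map_neg]
    abel
  rw [Matrix.eval_charpoly, h, Matrix.det_neg, det_add_symbol]
  norm_num

/-- The multiset `s` consists of the roots of `f` in `(-∞, 0]`, with multiplicities. -/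
def IsNonposRoots (f : Polynomial ℝ) (s : Multiset ℝ) : Prop :=
  ∀ μ ≤ 0, f.rootMultiplicity μ = s.count μ

-- Real polynomials agreeing at every point are equal, and the factor `g` adds no multiplicity on
-- `(-∞, 0]`.
open Polynomial in
theorem isNonposRoots_of_eval_eq {f g : Polynomial ℝ} {s : Multiset ℝ}
    (h : ∀ x, f.eval x = (s.map fun a => x - a).prod * g.eval x) (hg : ∀ x ≤ 0, g.eval x ≠ 0) :
    IsNonposRoots f s := fun μ hμ => by
  have hf : f = (s.map fun a => X - C a).prod * g := by
    refine Polynomial.funext fun x => ?_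
    rw [h, eval_mul, eval_multiset_prod, Multiset.map_map]
    simp
  have hg0 : g ≠ 0 := fun h0 => hg 0 le_rfl (by simp [h0])
  have hs0 : (s.map fun a => X - C a).prod ≠ 0 :=
    (monic_multiset_prod_of_monic s _ fun a _ => monic_X_sub_C a).ne_zero
  rw [hf, rootMultiplicity_mul (mul_ne_zero hs0 hg0), ← count_roots, roots_multiset_prod_X_sub_C,
    rootMultiplicity_eq_zero (hg μ hμ), add_zero]

/-- The multiplicity of the eigenvalue `0` in the mode `k`. -/
def modeNullity (k : ℤ × ℤ) : ℕ :=
  match k.1.natAbs, k.2.natAbs with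
  | 0, 0 => 4
  | 2, 0 => 1
  | 0, 1 => 3
  | 0, 2 => 1
  | 2, 1 => 1
  | _, _ => 0

/-- The number of negative eigenvalues in the mode `k`. -/
def modeIndexCount (k : ℤ × ℤ) : ℕ :=
  match k.1.natAbs, k.2.natAbs with
  | 0, 0 => 1
  | 1, 0 => 2
  | 2, 0 => 1
  | 1, 1 => 1
  | _, _ => 0

theorem modeCounts_eq_zero {k : ℤ × ℤ}
    (hk : k ∉ (Finset.Icc (-2) 2 ×ˢ Finset.Icc (-2) 2 : Finset (ℤ × ℤ))) :
    modeNullity k = 0 ∧ modeIndexCount k = 0 := by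
  obtain ⟨m, n⟩ := k
  simp only [Finset.mem_product, Finset.mem_Icc] at hk
  unfold modeNullity modeIndexCount
  simp only
  constructor <;> split <;> first | rfl | omega

section Factorizations

variable {f : Polynomial ℝ}

open Polynomial

theorem exists_nonposRoots_zero_zero (h : ∀ x, f.eval x = -symbolDet 0 0 (-x)) :
    ∃ s, IsNonposRoots f s ∧ s.count 0 = 4 ∧ (s.filter (· < 0)).card = 1 := by
  refine ⟨{-4, 0, 0, 0, 0}, isNonposRoots_of_eval_eq (g := 1) (fun x => ?_) (by simp), ?_, ?_⟩
  · rw [h]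
    simp [symbolDet, detCoeffZero, detCoeffOne, detCoeffTwo, detCoeffThree, detCoeffFour]
    ring
  · simp
  · simp [Multiset.filter_singleton]

theorem exists_nonposRoots_one_zero (h : ∀ x, f.eval x = -symbolDet 1 0 (-x)) :
    ∃ s, IsNonposRoots f s ∧ s.count 0 = 0 ∧ (s.filter (· < 0)).card = 2 := by
  have hq : Real.sqrt 24 ^ 2 = 24 := Real.sq_sqrt (by norm_num)
  have hq4 : 4 < Real.sqrt 24 := Real.lt_sqrt_of_sq_lt (by norm_num)
  have hr : 3 - Real.sqrt 24 < 0 := by linarith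
  -- The characteristic polynomial is `(x + 1)(x - 1)(x - 15)(x² - 6x - 15)`; the last factor has
  -- roots `3 ± √24`.
  refine ⟨{-1, 3 - Real.sqrt 24}, isNonposRoots_of_eval_eq
    (g := (X - C 15) * (X - C 1) * (X - C (3 + Real.sqrt 24))) (fun x => ?_) (fun x hx => ?_),
    ?_, ?_⟩
  · rw [h]
    simp [symbolDet, detCoeffZero, detCoeffOne, detCoeffTwo, detCoeffThree, detCoeffFour]
    linear_combination (x + 1) * (x - 15) * (x - 1) * hq
  · simp only [eval_mul, eval_sub, eval_X, eval_C]
    exact mul_ne_zero (mul_ne_zero (by linarith) (by linarith)) (by linarith)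
  · simp [hr.ne']
  · simp [Multiset.filter_singleton, hr]

theorem exists_nonposRoots_four_zero (h : ∀ x, f.eval x = -symbolDet 4 0 (-x)) :
    ∃ s, IsNonposRoots f s ∧ s.count 0 = 1 ∧ (s.filter (· < 0)).card = 1 := by
  -- The characteristic polynomial is `x (x - 80)` times this cubic, which changes sign on `[-10,
  -- 0]`. The quadratic in `g` below is the cubic divided by `x - r`; it is positive for `x ≤ 0`
  -- because `r < 0`.
  obtain ⟨r, hr, hr0⟩ : ∃ r : ℝ, r < 0 ∧ r ^ 3 - 76 * r ^ 2 + 768 * r + 3840 = 0 := by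
    obtain ⟨r, hr, h0⟩ := intermediate_value_Icc (show (-10 : ℝ) ≤ 0 by norm_num)
      (f := fun r : ℝ => r ^ 3 - 76 * r ^ 2 + 768 * r + 3840) (by fun_prop)
      (show (0 : ℝ) ∈ _ by norm_num)
    exact ⟨r, lt_of_le_of_ne hr.2 fun hz => by norm_num [hz] at h0, h0⟩
  refine ⟨{0, r}, isNonposRoots_of_eval_eq
    (g := (X - C 80) * (X ^ 2 + C (r - 76) * X + C (r ^ 2 - 76 * r + 768)))
    (fun x => ?_) (fun x hx => ?_), ?_, ?_⟩
  · rw [h]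
    simp [symbolDet, detCoeffZero, detCoeffOne, detCoeffTwo, detCoeffThree, detCoeffFour]
    linear_combination x * (x - 80) * hr0
  · simp only [eval_mul, eval_sub, eval_add, eval_pow, eval_X, eval_C]
    refine mul_ne_zero (by linarith) (ne_of_gt ?_)
    nlinarith [mul_nonneg_of_nonpos_of_nonpos (show r - 76 ≤ 0 by linarith) hx, sq_nonneg r,
      sq_nonneg x]
  · simp [hr.ne']
  · simp [Multiset.filter_singleton, hr]

theorem exists_nonposRoots_zero_two (h : ∀ x, f.eval x = -symbolDet 0 2 (-x)) :
    ∃ s, IsNonposRoots f s ∧ s.count 0 = 3 ∧ (s.filter (· < 0)).card = 0 := by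
  refine ⟨{0, 0, 0}, isNonposRoots_of_eval_eq (g := (X - C 24) * (X - C 48)) (fun x => ?_)
    (fun x hx => ?_), ?_, ?_⟩
  · rw [h]
    simp [symbolDet, detCoeffZero, detCoeffOne, detCoeffTwo, detCoeffThree, detCoeffFour]
    ring
  · simp only [eval_mul, eval_sub, eval_X, eval_C]
    exact mul_ne_zero (by linarith) (by linarith)
  · simp
  · simp [Multiset.filter_singleton]

/-- Alternating signs exclude nonpositive roots. -/
theorem quartic_pos {a b c d x : ℝ} (ha : 0 ≤ a) (hb : 0 ≤ b) (hc : 0 ≤ c) (hd : 0 < d)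
    (hx : x ≤ 0) : 0 < x ^ 4 - a * x ^ 3 + b * x ^ 2 - c * x + d := by
  obtain ⟨y, rfl⟩ : ∃ y, x = -y := ⟨-x, by ring⟩
  have hy : 0 ≤ y := by linarith
  have e : (-y) ^ 4 - a * (-y) ^ 3 + b * (-y) ^ 2 - c * -y + d
    = y ^ 4 + a * y ^ 3 + b * y ^ 2 + c * y + d := by ring
  rw [e]
  positivity

theorem exists_nonposRoots_zero_eight (h : ∀ x, f.eval x = -symbolDet 0 8 (-x)) :
    ∃ s, IsNonposRoots f s ∧ s.count 0 = 1 ∧ (s.filter (· < 0)).card = 0 := by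
  refine ⟨{0}, isNonposRoots_of_eval_eq
    (g := X ^ 4 - C 540 * X ^ 3 + C 84480 * X ^ 2 - C 3529728 * X + C 29196288) (fun x => ?_)
    (fun x hx => ?_), ?_, ?_⟩
  · rw [h]
    simp [symbolDet, detCoeffZero, detCoeffOne, detCoeffTwo, detCoeffThree, detCoeffFour]
    ring
  · simp only [eval_mul, eval_sub, eval_add, eval_pow, eval_X, eval_C]
    exact (quartic_pos (by norm_num) (by norm_num) (by norm_num) (by norm_num) hx).ne'
  · simp
  · simp [Multiset.filter_singleton]

theorem exists_nonposRoots_four_two (h : ∀ x, f.eval x = -symbolDet 4 2 (-x)) :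
    ∃ s, IsNonposRoots f s ∧ s.count 0 = 1 ∧ (s.filter (· < 0)).card = 0 := by
  refine ⟨{0}, isNonposRoots_of_eval_eq
    (g := X ^ 4 - C 312 * X ^ 3 + C 27264 * X ^ 2 - C 804864 * X + C 5013504) (fun x => ?_)
    (fun x hx => ?_), ?_, ?_⟩
  · rw [h]
    simp [symbolDet, detCoeffZero, detCoeffOne, detCoeffTwo, detCoeffThree, detCoeffFour]
    ring
  · simp only [eval_mul, eval_sub, eval_add, eval_pow, eval_X, eval_C]
    exact (quartic_pos (by norm_num) (by norm_num) (by norm_num) (by norm_num) hx).ne'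
  · simp
  · simp [Multiset.filter_singleton]

theorem exists_nonposRoots_one_two (h : ∀ x, f.eval x = -symbolDet 1 2 (-x)) :
    ∃ s, IsNonposRoots f s ∧ s.count 0 = 0 ∧ (s.filter (· < 0)).card = 1 := by
  obtain ⟨r, hr, hr0⟩ : ∃ r : ℝ, r < 0 ∧
      r ^ 5 - 117 * r ^ 4 + 3162 * r ^ 3 - 19578 * r ^ 2 + 1317 * r + 59247 = 0 := by
    obtain ⟨r, hr, h0⟩ := intermediate_value_Icc (show (-10 : ℝ) ≤ 0 by norm_num)
      (f := fun r : ℝ => r ^ 5 - 117 * r ^ 4 + 3162 * r ^ 3 - 19578 * r ^ 2 + 1317 * r + 59247)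
      (by fun_prop) (show (0 : ℝ) ∈ _ by norm_num)
    exact ⟨r, lt_of_le_of_ne hr.2 fun hz => by norm_num [hz] at h0, h0⟩
  -- Synthetic division of the quintic by `x - r`: up to alternating signs, `a, b, c, d` are the
  -- coefficients of the quotient, and `r < 0` keeps them nonnegative.
  obtain ⟨a, ha, ha'⟩ : ∃ a, 0 ≤ a ∧ a = 117 - r := ⟨_, by linarith, rfl⟩
  obtain ⟨b, hb, hb'⟩ : ∃ b, 0 ≤ b ∧ b = 3162 - r * a := ⟨_, by nlinarith, rfl⟩
  obtain ⟨c, hc, hc'⟩ : ∃ c, 0 ≤ c ∧ c = 19578 - r * b := ⟨_, by nlinarith, rfl⟩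
  obtain ⟨d, hd, hd'⟩ : ∃ d, 0 < d ∧ d = 1317 - r * c := ⟨_, by nlinarith, rfl⟩
  refine ⟨{r}, isNonposRoots_of_eval_eq
    (g := X ^ 4 - C a * X ^ 3 + C b * X ^ 2 - C c * X + C d) (fun x => ?_)
    (fun x hx => ?_), ?_, ?_⟩
  · rw [h]
    simp [symbolDet, detCoeffZero, detCoeffOne, detCoeffTwo, detCoeffThree, detCoeffFour]
    subst hd' hc' hb' ha'
    linear_combination hr0
  · simp only [eval_mul, eval_sub, eval_add, eval_pow, eval_X, eval_C]
    exact (quartic_pos ha hb hc hd hx).ne'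
  · simp [hr.ne']
  · simp [Multiset.filter_singleton, hr]

theorem exists_nonposRoots_of_pos {p r : ℝ} (h : ∀ x, f.eval x = -symbolDet p r (-x))
    (hp : ∀ y, 0 ≤ y → 0 < symbolDet p r y) :
    ∃ s, IsNonposRoots f s ∧ s.count 0 = 0 ∧ (s.filter (· < 0)).card = 0 :=
  ⟨0, isNonposRoots_of_eval_eq (g := f) (by simp) fun x hx => by
    rw [h]
    exact neg_ne_zero.mpr (hp (-x) (by linarith)).ne', by simp, by simp⟩

end Factorizations

theorem exists_nonposRoots_modeSymbol (k : ℤ × ℤ) :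
    ∃ s, IsNonposRoots (modeSymbol k).charpoly s ∧ s.count 0 = modeNullity k ∧
      (s.filter (· < 0)).card = modeIndexCount k := by
  obtain ⟨m, n⟩ := k
  have hm : freq 0 (m, n) ^ 2 = (m.natAbs : ℝ) ^ 2 := by
    rw [freq_zero, Nat.cast_natAbs, Int.cast_abs, sq_abs]
  have hn : freq 1 (m, n) ^ 2 = 2 * (n.natAbs : ℝ) ^ 2 := by
    rw [freq_one, Nat.cast_natAbs, Int.cast_abs, sq_abs, mul_pow,
      Real.sq_sqrt (by norm_num : (0 : ℝ) ≤ 2)]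
  have h : ∀ x, (modeSymbol (m, n)).charpoly.eval x
      = -symbolDet ((m.natAbs : ℝ) ^ 2) (2 * (n.natAbs : ℝ) ^ 2) (-x) := fun x => by
    rw [modeSymbol, eval_charpoly_symbol, hm, hn]
  unfold modeNullity modeIndexCount
  simp only
  generalize (modeSymbol (m, n)).charpoly = f at h ⊢
  generalize m.natAbs = a at h ⊢
  generalize n.natAbs = b at h ⊢
  -- The complement of this region consists of the seven pairs `(0,0)`, `(0,1)`, `(0,2)`, `(1,0)`,
  -- `(1,1)`, `(2,0)`, `(2,1)`.
  by_cases hab : 3 ≤ a ∨ 3 ≤ b ∨ 1 ≤ a ∧ 2 ≤ b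
  · have hpos : ∀ y, 0 ≤ y → 0 < symbolDet ((a : ℝ) ^ 2) (2 * (b : ℝ) ^ 2) y := fun y hy => by
      refine symbolDet_pos (by positivity) (by positivity) hy ?_
      rcases hab with h3 | h3 | ⟨h1, h2⟩
      · have : (3 : ℝ) ≤ a := by exact_mod_cast h3
        left; nlinarith
      · have : (3 : ℝ) ≤ b := by exact_mod_cast h3
        right; left; nlinarith
      · have h1' : (1 : ℝ) ≤ a := by exact_mod_cast h1
        have h2' : (2 : ℝ) ≤ b := by exact_mod_cast h2
        right; right; constructor <;> nlinarith
    have := exists_nonposRoots_of_pos h hpos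
    split <;> first | omega | (split <;> first | exact this | omega)
  · obtain ⟨ha, hb, hc⟩ : a ≤ 2 ∧ b ≤ 2 ∧ (a = 0 ∨ b ≤ 1) := by omega
    interval_cases a <;> interval_cases b <;> norm_num at h hc
    · exact exists_nonposRoots_zero_zero h
    · exact exists_nonposRoots_zero_two h
    · exact exists_nonposRoots_zero_eight h
    · exact exists_nonposRoots_one_zero h
    · exact exists_nonposRoots_one_two h
    · exact exists_nonposRoots_four_zero h
    · exact exists_nonposRoots_four_two h

/-- The index sums over uncountably many candidates `μ`. By induction on `s`, each added root
contributes one at the single index equal to it if it is negative, and nothing otherwise. -/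
theorem sum_count_eq_card_filter (s : Multiset ℝ) :
    (Cardinal.sum fun μ : Set.Iio (0 : ℝ) => ((s.count (μ : ℝ) : ℕ) : Cardinal.{0}))
      = ((s.filter (· < 0)).card : Cardinal.{0}) := by
  induction s using Multiset.induction_on with
  | empty => simp
  | cons a s ih =>
    have h1 : (Cardinal.sum fun μ : Set.Iio (0 : ℝ) =>
        ((if (μ : ℝ) = a then 1 else 0 : ℕ) : Cardinal.{0}))
          = ((if a < 0 then 1 else 0 : ℕ) : Cardinal.{0}) := by
      -- Writing the indicator as the cardinality of a proposition turns the sum into that of a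
      -- sigma type with at most one element.
      have h2 : ∀ μ : Set.Iio (0 : ℝ), ((if (μ : ℝ) = a then 1 else 0 : ℕ) : Cardinal.{0})
          = Cardinal.mk (PLift ((μ : ℝ) = a)) := fun μ => by
        split_ifs with h <;> simp [h]
      simp only [h2]
      rw [← Cardinal.mk_sigma]
      split_ifs with ha
      · have : Unique (Σ μ : Set.Iio (0 : ℝ), PLift ((μ : ℝ) = a)) :=
          ⟨⟨⟨⟨a, ha⟩, ⟨rfl⟩⟩⟩, fun ⟨⟨b, hb⟩, ⟨h⟩⟩ => by
            obtain rfl : b = a := h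
            rfl⟩
        simp
      · have : IsEmpty (Σ μ : Set.Iio (0 : ℝ), PLift ((μ : ℝ) = a)) :=
          ⟨fun ⟨⟨b, hb⟩, ⟨h⟩⟩ => ha (by
            obtain rfl : b = a := h
            exact hb)⟩
        simp
    have h3 : (fun μ : Set.Iio (0 : ℝ) => (((a ::ₘ s).count (μ : ℝ) : ℕ) : Cardinal.{0}))
        = (fun μ : Set.Iio (0 : ℝ) => ((s.count (μ : ℝ) : ℕ) : Cardinal.{0}))
          + fun μ : Set.Iio (0 : ℝ) => ((if (μ : ℝ) = a then 1 else 0 : ℕ) : Cardinal.{0}) := by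
      funext μ
      rw [Multiset.count_cons]
      push_cast
      rfl
    rw [h3, Cardinal.sum_add_distrib, ih, h1, Multiset.filter_cons, add_comm, Multiset.card_add]
    split_ifs <;> simp

end Sasahara

end BiharmonicIndex

end

open BiharmonicIndex BiharmonicIndex.Sasahara in
theorem theorem1p6 :
    BiharmonicIndex.SphereMap.index BiharmonicIndex.sasahara = 11 ∧
      BiharmonicIndex.SphereMap.nullity BiharmonicIndex.sasahara = 18 := by
  choose s hs hs0 hsn using exists_nonposRoots_modeSymbol
  let K : Finset (ℤ × ℤ) := Finset.Icc (-2) 2 ×ˢ Finset.Icc (-2) 2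
  have hK : ∀ k ∉ K, ∀ μ ≤ 0, (s k).count μ = 0 := fun k hk μ hμ => by
    rcases hμ.lt_or_eq with h | rfl
    · have h0 := (hsn k).trans (modeCounts_eq_zero hk).2
      rw [Multiset.card_eq_zero, Multiset.filter_eq_nil] at h0
      exact Multiset.count_eq_zero.mpr fun hm => h0 μ hm h
    · exact (hs0 k).trans (modeCounts_eq_zero hk).1
  have hrank : ∀ μ ≤ 0, Module.rank ℝ (Module.End.eigenspace sasahara.jacobi2 μ)
      = (((∑ k ∈ K, s k).count μ : ℕ) : Cardinal) := fun μ hμ => by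
    rw [rank_eigenspace_jacobi2 fun k hk => (hs k μ hμ).trans (hK k hk μ hμ),
      Multiset.count_sum']
    exact congrArg _ (Finset.sum_congr rfl fun k _ => hs k μ hμ)
  constructor
  · have h : ∀ μ : Set.Iio (0 : ℝ), Module.rank ℝ (Module.End.eigenspace sasahara.jacobi2 (μ : ℝ))
        = (((∑ k ∈ K, s k).count (μ : ℝ) : ℕ) : Cardinal) := fun μ => hrank μ (le_of_lt μ.2)
    rw [SphereMap.index, funext h, sum_count_eq_card_filter, ← Multiset.countP_eq_card_filter,
      ← Multiset.coe_countPAddMonoidHom, map_sum]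
    simp only [Multiset.coe_countPAddMonoidHom, Multiset.countP_eq_card_filter, hsn]
    -- The origin gives 1, the modes `(±1, 0)` give 2 each, `(±2, 0)` and `(±1, ±1)` give 1 each: `1
    -- + 4 + 2 + 4 = 11`.
    rfl
  · rw [SphereMap.nullity, ← Module.End.eigenspace_zero, hrank 0 le_rfl, Multiset.count_sum',
      Finset.sum_congr rfl fun k _ => hs0 k]
    -- The origin gives 4, `(0, ±1)` give 3 each, `(±2, 0)`, `(0, ±2)` and `(±2, ±1)` give 1 each:
    -- `4 + 6 + 2 + 2 + 4 = 18`.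
    rfl
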